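/- Let $S^n$ be the space of real symmetric $n\times n$ matrices, $n\ge 1$, let $L:S^n\to S^n$ be linear and monotone ($\mathrm{Tr}(X\,L(X))\ge 0$ for all $X\in S^n$), and let $Q\in S^n$. Call $(X,Y)$ strictly feasible if $X\succ0$, $Y\succ 0$ and $Y=L(X)+Q$. Let $$\psi(t)=\tfrac12\Big(2t^2+\frac1{t^2}-5\Big)+e^{\frac1t-1}\qquad(t>0),$$ and let $\rho:[0,\infty)\to(0,1]$ be the inverse function of the restriction of $-\tfrac12\psi'$ to $(0,1]$. Functions are applied to symmetric matrices spectrally. For $V\succ 0$ put $\Psi(V)=\mathrm{Tr}\,\psi(V)$ and $\delta(V)=\frac12\sqrt{\mathrm{Tr}(\psi'(V)^2)}$. For $X,Y\succ0$ and $\mu>0$ let $P=X^{1/2}(X^{1/2}YX^{1/2})^{-1/2}X^{1/2}$, $D=P^{1/2}$ (Nesterov–Todd scaling), $V=\mu^{-1/2}D^{-1}XD^{-1}$ and $\Psi(X,Y,\mu)=\Psi(V)$. Consider the following algorithm. Input: $\tau\ge1$, $\varepsilon>0$, $0<\theta<1$, and a strictly feasible $(X^0,Y^0)$ such that $\Psi(X^0,Y^0,\mu^0)\le\tau$,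 where $\mu^0=\mathrm{Tr}(X^0Y^0)/n$. Start from $(X,Y,\mu)=(X^0,Y^0,\mu^0)$. While $n\mu\ge\varepsilon$, perform an outer iteration: replace $\mu$ by $(1-\theta)\mu$ and then, while $\Psi(X,Y,\mu)>\tau$, perform inner iterations. An inner iteration solves $$D_X+D_Y=-\psi'(V),\qquad D\,L(D D_X D)\,D=D_Y$$ for $D_X,D_Y\in S^n$, puts $\Delta X=\sqrt\mu\,D D_X D$ and $\Delta Y=\sqrt\mu\,D^{-1}D_YD^{-1}$, and replaces $(X,Y)$ by $(X,Y)+\alpha(\Delta X,\Delta Y)$ with the default step size $\alpha=1/\psi''(\rho(2\delta(V)))$. Let $$\Psi_0=\frac{2}{1-\theta}\big(\sqrt{2\tau}+\sqrt n\,\theta\big)^2 .$$ **(1)** The algorithm is well defined (as long as it has not stopped, the next iterate exists and is unique), all iterates $(X,Y)$ are strictly feasible, $\Psi(X,Y,\mu)\le\Psi_0$ throughout, and the total number of iterations (inner and outer iterations together) is at most $$66\Big(1+\log\big(2\sqrt{2\Psi_0}+1\big)\Big)^2\,\Psi_0^{1/2}\,\max\Big\{1,\ \frac1\theta\log\frac{n\mu^0}{\varepsilon}\Big\}.$$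 In particular, it is at most $66(1+\log(2\sqrt{2\Psi_0}+1))^2\,\Psi_0^{1/2}\,\frac1\theta\log\frac{n\mu^0}{\varepsilon}$ whenever $\log\frac{n\mu^0}{\varepsilon}\ge\theta$. The same bound holds if $\Psi_0$ is replaced by any number $\ge 1$ that bounds the values of $\Psi(X,Y,\mu)$ directly after the $\mu$-updates. **(2)** If $\tau=O(n)$, $\theta=\Theta(1)$ and $\mu^0=O(1)$, the total number of iterations is $O\big(\sqrt n\,(\log n)^2\log\frac n\varepsilon\big)$. Precisely: for all real $c,M$ and all $\theta_1>0$, $\theta_2<1$ there is a constant $C>0$, depending only on $c,M,\theta_1,\theta_2$, such that for all $n\ge2$ and all inputs as above with $\tau\le cn$, $\theta_1\le\theta\le\theta_2$, $\mu^0\le M$ and $\varepsilon\le n/2$, the total number of iterations is at most $C\sqrt n\,(\log n)^2\log\frac n\varepsilon$. -/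

import Mathlib

namespace SDLCP

noncomputable section

/-- The space of real symmetric `n × n` matrices (for real matrices `star` is the transpose). -/
abbrev SymMat (n : ℕ) : Submodule ℝ (Matrix (Fin n) (Fin n) ℝ) :=
  selfAdjoint.submodule ℝ (Matrix (Fin n) (Fin n) ℝ)

/-- The congruence `Z ↦ D Z Dᵀ` on symmetric matrices (it is `D Z D` for a symmetric `D`). -/
def congruence {n : ℕ} (D : Matrix (Fin n) (Fin n) ℝ) (Z : SymMat n) : SymMat n :=
  ⟨D * (Z : Matrix (Fin n) (Fin n) ℝ) * D.transpose, by
    have hZ : (Z : Matrix (Fin n) (Fin n) ℝ).transpose = Z := by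
      have h : star (Z : Matrix (Fin n) (Fin n) ℝ) = Z := Z.2
      rwa [Matrix.star_eq_conjTranspose, Matrix.conjTranspose_eq_transpose_of_trivial] at h
    change star (D * (Z : Matrix (Fin n) (Fin n) ℝ) * D.transpose) = _
    rw [Matrix.star_eq_conjTranspose, Matrix.conjTranspose_eq_transpose_of_trivial,
      Matrix.transpose_mul, Matrix.transpose_mul, Matrix.transpose_transpose, hZ,
      Matrix.mul_assoc]⟩

/-- The matrix function `f(A) = Qᵀ diag(f(λ₁(A)), …, f(λₙ(A))) Q` of a symmetric matrix `A`
(the spectrum is finite, so the functional calculus applies to every `f`). -/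
def matFun {n : ℕ} (f : ℝ → ℝ) (A : SymMat n) : SymMat n :=
  ⟨cfc f (A : Matrix (Fin n) (Fin n) ℝ), cfc_predicate f _⟩

/-- The kernel function. -/
def psi (t : ℝ) : ℝ :=
  1 / 2 * (2 * t ^ 2 + 1 / t ^ 2 - 5) + Real.exp (1 / t - 1)

/-- The inverse function `[0, ∞) → (0, 1]` of the restriction of `-ψ'/2` to `(0, 1]`. -/
def rho (s : ℝ) : ℝ :=
  Function.invFunOn (fun t => -(1 / 2) * deriv psi t) (Set.Ioc 0 1) s

/-- The barrier function `Ψ(V) = Tr ψ(V)`. -/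
def barrier {n : ℕ} (V : SymMat n) : ℝ :=
  (matFun psi V : Matrix (Fin n) (Fin n) ℝ).trace

/-- The proximity measure `δ(V) = ½ ‖ψ'(V)‖_F`. -/
def delta {n : ℕ} (V : SymMat n) : ℝ :=
  1 / 2 * Real.sqrt ((matFun (deriv psi) V : Matrix (Fin n) (Fin n) ℝ) *
    (matFun (deriv psi) V : Matrix (Fin n) (Fin n) ℝ)).trace

/-- The default step size `1 / ψ''(ρ(2δ))`. -/
def stepSize {n : ℕ} (V : SymMat n) : ℝ :=
  1 / deriv (deriv psi) (rho (2 * delta V))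

/-- The Nesterov–Todd matrix `P = X^{1/2} (X^{1/2} Y X^{1/2})^{-1/2} X^{1/2}`. -/
def ntP {n : ℕ} (X Y : SymMat n) : SymMat n :=
  congruence (matFun Real.sqrt X : Matrix (Fin n) (Fin n) ℝ)
    (matFun (fun t => 1 / Real.sqrt t)
      (congruence (matFun Real.sqrt X : Matrix (Fin n) (Fin n) ℝ) Y))

/-- The scaling matrix `D = P^{1/2}`. -/
def ntD {n : ℕ} (X Y : SymMat n) : Matrix (Fin n) (Fin n) ℝ :=
  (matFun Real.sqrt (ntP X Y) : Matrix (Fin n) (Fin n) ℝ)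

/-- The scaled matrix `V = μ^{-1/2} D⁻¹ X D⁻¹`. -/
def ntV {n : ℕ} (X Y : SymMat n) (μ : ℝ) : SymMat n :=
  (1 / Real.sqrt μ) • congruence (ntD X Y)⁻¹ X

/-- The current values of the variables of the algorithm. -/
structure State (n : ℕ) where
  X : SymMat n
  Y : SymMat n
  μ : ℝ

/-- The scaled matrix of a state. -/
def State.V {n : ℕ} (s : State n) : SymMat n := ntV s.X s.Y s.μ

/-- The value `Ψ(X, Y, μ)` at a state. -/
def State.Psi {n : ℕ} (s : State n) : ℝ := barrier s.V

/-- The scaled system for the search directions: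
`D_X + D_Y = -ψ'(V)` and `D_Y = L̃(D_X) = D L(D D_X D) D`. -/
def IsScaledDirection {n : ℕ} (L : SymMat n →ₗ[ℝ] SymMat n) (s : State n)
    (DX DY : SymMat n) : Prop :=
  DX + DY = -matFun (deriv psi) s.V ∧
    congruence (ntD s.X s.Y) (L (congruence (ntD s.X s.Y) DX)) = DY

/-- One pass through the inner loop: if `Ψ > τ`, solve the system, put `ΔX = √μ D D_X D` and
`ΔY = √μ D⁻¹ D_Y D⁻¹`, and move along `(ΔX, ΔY)` with the default step size. -/
def InnerStep {n : ℕ} (L : SymMat n →ₗ[ℝ] SymMat n) (τ : ℝ) (s s' : State n) : Prop :=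
  τ < s.Psi ∧ ∃ DX DY : SymMat n, IsScaledDirection L s DX DY ∧
    s'.X = s.X + stepSize s.V • (Real.sqrt s.μ • congruence (ntD s.X s.Y) DX) ∧
    s'.Y = s.Y + stepSize s.V • (Real.sqrt s.μ • congruence (ntD s.X s.Y)⁻¹ DY) ∧
    s'.μ = s.μ

/-- One update of the barrier parameter (outer loop): if `Ψ ≤ τ` and `n μ ≥ ε`, then
`μ := (1 - θ) μ`. -/
def OuterStep {n : ℕ} (τ ε θ : ℝ) (s s' : State n) : Prop :=
  s.Psi ≤ τ ∧ ε ≤ n * s.μ ∧ s'.X = s.X ∧ s'.Y = s.Y ∧ s'.μ = (1 - θ) * s.μ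

/-- One iteration, inner or outer. -/
def Step {n : ℕ} (L : SymMat n →ₗ[ℝ] SymMat n) (τ ε θ : ℝ) (s s' : State n) : Prop :=
  InnerStep L τ s s' ∨ OuterStep τ ε θ s s'

/-- Both loop conditions fail. -/
def Halted {n : ℕ} (τ ε : ℝ) (s : State n) : Prop :=
  s.Psi ≤ τ ∧ n * s.μ < ε

/-- The pairs in `F⁰`. -/
def StrictlyFeasible {n : ℕ} (L : SymMat n →ₗ[ℝ] SymMat n) (Q X Y : SymMat n) : Prop :=
  Y = L X + Q ∧ (X : Matrix (Fin n) (Fin n) ℝ).PosDef ∧ (Y : Matrix (Fin n) (Fin n) ℝ).PosDef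

/-- Monotonicity of the linear transformation: `X • L(X) ≥ 0`. -/
def IsMonotone {n : ℕ} (L : SymMat n →ₗ[ℝ] SymMat n) : Prop :=
  ∀ X : SymMat n,
    0 ≤ ((X : Matrix (Fin n) (Fin n) ℝ) * (L X : Matrix (Fin n) (Fin n) ℝ)).trace

/-- `μ⁰ = Tr(X⁰ Y⁰) / n`. -/
def mu0 {n : ℕ} (X₀ Y₀ : SymMat n) : ℝ :=
  ((X₀ : Matrix (Fin n) (Fin n) ℝ) * (Y₀ : Matrix (Fin n) (Fin n) ℝ)).trace / n

/-- The initial state. -/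
def initState {n : ℕ} (X₀ Y₀ : SymMat n) : State n := ⟨X₀, Y₀, mu0 X₀ Y₀⟩

/-- The admissible inputs of the algorithm. -/
structure IsInput {n : ℕ} (L : SymMat n →ₗ[ℝ] SymMat n) (Q X₀ Y₀ : SymMat n)
    (τ ε θ : ℝ) : Prop where
  n_pos : 0 < n
  monotone : IsMonotone L
  feasible : StrictlyFeasible L Q X₀ Y₀
  one_le_tau : 1 ≤ τ
  eps_pos : 0 < ε
  theta_pos : 0 < θ
  theta_lt_one : θ < 1
  init_le : (initState X₀ Y₀).Psi ≤ τ

/-- `s 0, …, s N` are the states in the first `N` iterations of an execution. -/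
structure IsRun {n : ℕ} (L : SymMat n →ₗ[ℝ] SymMat n) (X₀ Y₀ : SymMat n) (τ ε θ : ℝ)
    (N : ℕ) (s : ℕ → State n) : Prop where
  init : s 0 = initState X₀ Y₀
  step : ∀ i < N, Step L τ ε θ (s i) (s (i + 1))

/-- `Ψ₀ = 2 (√(2τ) + √n θ)² / (1 - θ)`. -/
def Psi0 (n : ℕ) (τ θ : ℝ) : ℝ :=
  2 / (1 - θ) * (Real.sqrt (2 * τ) + Real.sqrt n * θ) ^ 2

end

end SDLCP

namespace SDLCP

open Matrix

/-! Two facts drive the bound: every inner step lowers `Ψ` by a definite amount, and every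
`μ`-update raises it to at most `Ψ₀`.

Inner step. In scaled coordinates both iterates equal `V` before the step, and `V + αD_X`, `V +
αD_Y` after it. The new `Ψ` is at most the mean of `Tr ψ` at these two matrices
(`barrier_ntV_le_mean`). This rests on the splitting `ψ(t) = t² - 5/2 + psiInv(1/t)`: the square
part is handled by `2 Tr AB ≤ Tr A² + Tr B²`, and the convex increasing `psiInv` by the Peierls
inequality. Each of the two traces is then estimated by a second-order Klein inequality (`klein`),
so no matrix function is ever differentiated. As `ψ''` is decreasing, its coefficient is `ψ''(r)`
once all eigenvalues involved are at least `r = ρ(2δ)`, and `α = 1/ψ''(r)` is small enough to ensure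
this (`eigenvalues_step_ge`). Monotonicity of `L` gives `Tr(D_X D_Y) ≥ 0`, hence `‖D_X‖² + ‖D_Y‖² ≤
4δ²`, and the decrease is at least `αδ²` (`mean_trace_psi_step`). Since `δ ≥ √Ψ` and `ψ''(ρ(2δ)) =
O(δ log² δ)`, this is at least `2√Ψ/c` with `c = 25(1 + log(2√(2B) + 1))²`, for any bound `B` on `Ψ`
(`decrease_ge`).

Counting. Completing the square shows that `c√Ψ` drops by at least 1 in each inner step, and an
update resets it to at most `c√B`. So `k` updates allow at most `k(1 + c√B)` iterations
(`run_count`). The geometric decay of `μ` bounds `k`, and `sum_psi_mul_le` permits `B = Ψ₀`. Part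
(2) inserts the sizes of the parameters. -/

/-! ### Calculus of the kernel function. -/

/-- The first derivative of the kernel function. -/
noncomputable def psi1 (t : ℝ) : ℝ := 2 * t - 1 / t ^ 3 - Real.exp (1 / t - 1) / t ^ 2

/-- The second derivative of the kernel function. -/
noncomputable def psi2 (t : ℝ) : ℝ :=
  2 + 3 / t ^ 4 + Real.exp (1 / t - 1) * (1 / t ^ 4 + 2 / t ^ 3)

lemma hasDerivAt_exp_inv {t : ℝ} (ht : t ≠ 0) :
    HasDerivAt (fun x : ℝ => Real.exp (1 / x - 1)) (-(Real.exp (1 / t - 1) / t ^ 2)) t := by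
  have h := ((hasDerivAt_inv ht).sub_const 1).exp
  simp only [← one_div] at h
  convert h using 1
  field_simp

lemma hasDerivAt_psi {t : ℝ} (ht : t ≠ 0) : HasDerivAt psi (psi1 t) t := by
  have h1 : HasDerivAt (fun x : ℝ => 1 / x ^ 2) (-2 / t ^ 3) t := by
    have := (hasDerivAt_pow 2 t).inv (pow_ne_zero 2 ht)
    simp only [← one_div] at this
    refine HasDerivAt.congr_deriv this ?_
    field_simp
    push_cast
    ring
  have h2 := ((((hasDerivAt_pow 2 t).const_mul 2).add h1).sub_const 5).const_mul (1 / 2)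
  refine HasDerivAt.congr_deriv (h2.add (hasDerivAt_exp_inv ht)) ?_
  unfold psi1
  field_simp
  push_cast
  ring

lemma hasDerivAt_psi1 {t : ℝ} (ht : t ≠ 0) : HasDerivAt psi1 (psi2 t) t := by
  have h1 : HasDerivAt (fun x : ℝ => 1 / x ^ 3) (-3 / t ^ 4) t := by
    have := (hasDerivAt_pow 3 t).inv (pow_ne_zero 3 ht)
    simp only [← one_div] at this
    refine HasDerivAt.congr_deriv this ?_
    field_simp
    push_cast
    ring
  have h2 := (((hasDerivAt_id t).const_mul 2).sub h1).sub
    ((hasDerivAt_exp_inv ht).div (hasDerivAt_pow 2 t) (pow_ne_zero 2 ht))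
  refine HasDerivAt.congr_deriv h2 ?_
  unfold psi2
  field_simp
  push_cast
  ring

lemma deriv_psi {t : ℝ} (ht : t ≠ 0) : deriv psi t = psi1 t := (hasDerivAt_psi ht).deriv

lemma deriv_deriv_psi {t : ℝ} (ht : t ≠ 0) : deriv (deriv psi) t = psi2 t := by
  have h : deriv psi =ᶠ[nhds t] psi1 := by
    filter_upwards [isOpen_ne.mem_nhds ht] with x hx using deriv_psi hx
  rw [h.deriv_eq, (hasDerivAt_psi1 ht).deriv]

lemma psi2_anti {s t : ℝ} (hs : 0 < s) (hst : s ≤ t) : psi2 t ≤ psi2 s := by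
  unfold psi2
  have ht : 0 < t := hs.trans_le hst
  gcongr

lemma two_le_psi2 {t : ℝ} (ht : 0 < t) : 2 ≤ psi2 t := by
  unfold psi2
  have : 0 < 3 / t ^ 4 + Real.exp (1 / t - 1) * (1 / t ^ 4 + 2 / t ^ 3) := by positivity
  linarith

lemma psi_one : psi 1 = 0 := by norm_num [psi]

lemma psi1_one : psi1 1 = 0 := by norm_num [psi1]

lemma psi2_one : psi2 1 = 8 := by norm_num [psi2]

/-- A convex function lies above its tangents. -/
lemma tangent_le_of_convexOn {S : Set ℝ} {f : ℝ → ℝ} {f' x y : ℝ} (hf : ConvexOn ℝ S f)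
    (hx : x ∈ S) (hy : y ∈ S) (hd : HasDerivAt f f' x) : f x + f' * (y - x) ≤ f y := by
  rcases lt_trichotomy x y with h | h | h
  · have := hf.le_slope_of_hasDerivAt hx hy h hd
    rw [slope_def_field, le_div_iff₀ (by linarith)] at this
    linarith
  · subst h; simp
  · have := hf.slope_le_of_hasDerivAt hy hx h hd
    rw [slope_def_field, div_le_iff₀ (by linarith)] at this
    linarith

/-- Second order lower bound for a function with second derivative at least `k`. -/
lemma taylor_lower {S : Set ℝ} (hS : Convex ℝ S) {f f' f'' : ℝ → ℝ} {k : ℝ}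
    (h1 : ∀ x ∈ S, HasDerivAt f (f' x) x) (h2 : ∀ x ∈ S, HasDerivAt f' (f'' x) x)
    (hk : ∀ x ∈ S, k ≤ f'' x) {v a : ℝ} (hv : v ∈ S) (ha : a ∈ S) :
    f v + f' v * (a - v) + k / 2 * (a - v) ^ 2 ≤ f a := by
  have d1 : ∀ x ∈ S, HasDerivAt (fun x => f x - k / 2 * x ^ 2) (f' x - k * x) x := fun x hx => by
    refine ((h1 x hx).sub ((hasDerivAt_pow 2 x).const_mul (k / 2))).congr_deriv ?_
    push_cast; ring
  have d2 : ∀ x ∈ S, HasDerivAt (fun x => f' x - k * x) (f'' x - k) x := fun x hx => by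
    refine ((h2 x hx).sub ((hasDerivAt_id x).const_mul k)).congr_deriv ?_
    ring
  have hc : ConvexOn ℝ S (fun x => f x - k / 2 * x ^ 2) := by
    refine convexOn_of_hasDerivWithinAt2_nonneg (f' := fun x => f' x - k * x)
      (f'' := fun x => f'' x - k) hS
      (fun x hx => (d1 x hx).continuousAt.continuousWithinAt)
      (fun x hx => (d1 x (interior_subset hx)).hasDerivWithinAt)
      (fun x hx => (d2 x (interior_subset hx)).hasDerivWithinAt)
      (fun x hx => sub_nonneg.2 (hk x (interior_subset hx)))
  have := tangent_le_of_convexOn hc hv ha (d1 v hv)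
  nlinarith

/-- Second order upper bound for a function with second derivative at most `k`. -/
lemma taylor_upper {S : Set ℝ} (hS : Convex ℝ S) {f f' f'' : ℝ → ℝ} {k : ℝ}
    (h1 : ∀ x ∈ S, HasDerivAt f (f' x) x) (h2 : ∀ x ∈ S, HasDerivAt f' (f'' x) x)
    (hk : ∀ x ∈ S, f'' x ≤ k) {v a : ℝ} (hv : v ∈ S) (ha : a ∈ S) :
    f a ≤ f v + f' v * (a - v) + k / 2 * (a - v) ^ 2 := by
  have := taylor_lower hS (f := fun x => -f x) (f' := fun x => -f' x) (f'' := fun x => -f'' x)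
    (k := -k) (fun x hx => (h1 x hx).neg) (fun x hx => (h2 x hx).neg)
    (fun x hx => neg_le_neg (hk x hx)) hv ha
  linarith

/-- Strong convexity, from `ψ'' ≥ 2`. The lower bounds for `ψ`, for increments of `ψ'` and for `δ`
all come from it. -/
lemma psi_lower {v a : ℝ} (hv : 0 < v) (ha : 0 < a) :
    psi v + psi1 v * (a - v) + (a - v) ^ 2 ≤ psi a := by
  have := taylor_lower (convex_Ioi (0 : ℝ)) (f := psi) (f' := psi1) (f'' := psi2) (k := 2)
    (fun x hx => hasDerivAt_psi (ne_of_gt hx)) (fun x hx => hasDerivAt_psi1 (ne_of_gt hx))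
    (fun x hx => two_le_psi2 hx) hv ha
  linarith

/-- Since `ψ''` is decreasing, its maximum on `[m, ∞)` is attained at `m`. Hence only lower bounds
on eigenvalues are needed later. -/
lemma psi_upper {m v a : ℝ} (hm : 0 < m) (hv : m ≤ v) (ha : m ≤ a) :
    psi a ≤ psi v + psi1 v * (a - v) + psi2 m / 2 * (a - v) ^ 2 :=
  taylor_upper (convex_Ici m) (f := psi) (f' := psi1) (f'' := psi2)
    (fun _ hx => hasDerivAt_psi (hm.trans_le hx).ne')
    (fun _ hx => hasDerivAt_psi1 (hm.trans_le hx).ne')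
    (fun _ hx => psi2_anti hm hx) hv ha

/-- Add the second-order bounds taken at `v` and at `a`; the values of `ψ` cancel. -/
lemma psi1_lower {v a : ℝ} (hv : 0 < v) (ha : v ≤ a) : 2 * (a - v) ≤ psi1 a - psi1 v := by
  have h1 := psi_lower hv (hv.trans_le ha)
  have h2 := psi_lower (hv.trans_le ha) hv
  rcases ha.eq_or_lt with rfl | h
  · simp
  · have : (a - v) * (2 * (a - v)) ≤ (a - v) * (psi1 a - psi1 v) := by linarith
    exact le_of_mul_le_mul_left this (by linarith)

lemma psi1_upper {v a : ℝ} (hv : 0 < v) (ha : v ≤ a) :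
    psi1 a - psi1 v ≤ psi2 v * (a - v) := by
  have h1 := psi_upper hv le_rfl ha
  have h2 := psi_upper hv ha le_rfl
  rcases ha.eq_or_lt with rfl | h
  · simp
  · have : (a - v) * (psi1 a - psi1 v) ≤ (a - v) * (psi2 v * (a - v)) := by linarith
    exact le_of_mul_le_mul_left this (by linarith)

lemma lt_of_psi1_lt {v a : ℝ} (h : psi1 v < psi1 a) (ha : 0 < a) : v < a := by
  by_contra! hc
  have := psi1_lower ha hc
  linarith

lemma sq_sub_one_le_psi {t : ℝ} (ht : 0 < t) : (t - 1) ^ 2 ≤ psi t := by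
  have := psi_lower one_pos ht
  rw [psi_one, psi1_one] at this
  linarith

lemma psi_nonneg {t : ℝ} (ht : 0 < t) : 0 ≤ psi t := (sq_nonneg _).trans (sq_sub_one_le_psi ht)

/-- Strong convexity between `t` and the zero `1` of `ψ`, followed by completing the square. Summed
over eigenvalues it gives `Ψ ≤ δ²`. -/
lemma psi_le_psi1_sq {t : ℝ} (ht : 0 < t) : 4 * psi t ≤ psi1 t ^ 2 := by
  have := psi_lower ht one_pos
  rw [psi_one] at this
  nlinarith [sq_nonneg (2 * (1 - t) + psi1 t)]

lemma psi_le_four_mul {t : ℝ} (ht : 1 ≤ t) : psi t ≤ 4 * (t - 1) ^ 2 := by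
  have := psi_upper one_pos le_rfl ht
  rw [psi_one, psi1_one, psi2_one] at this
  linarith

lemma psi_le_sq_sub_one {t : ℝ} (ht : 1 ≤ t) : psi t ≤ t ^ 2 - 1 := by
  have h1 : 1 / t ^ 2 ≤ 1 := by
    rw [div_le_one (by positivity)]; nlinarith
  have h2 : Real.exp (1 / t - 1) ≤ 1 := by
    rw [Real.exp_le_one_iff, sub_nonpos, div_le_one (by positivity)]; exact ht
  unfold psi
  linarith

lemma psi_anti {s t : ℝ} (hs : 0 < s) (hst : s ≤ t) (ht : t ≤ 1) : psi t ≤ psi s := by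
  have h1 := psi_lower (hs.trans_le hst) hs
  have h2 := psi1_lower (hs.trans_le hst) ht
  rw [psi1_one] at h2
  nlinarith [sq_nonneg (s - t)]

/-! ### The inverse function and the size of the default step. -/

/-- The function `rho` takes values in `(0, 1]` and inverts `-ψ'/2`. -/
lemma rho_spec {s : ℝ} (hs : 0 ≤ s) : 0 < rho s ∧ rho s ≤ 1 ∧ psi1 (rho s) = -(2 * s) := by
  have key : ∃ t ∈ Set.Ioc (0 : ℝ) 1, (fun t => -(1 / 2) * deriv psi t) t = s := by
    -- Chosen so that `ψ'(b) ≤ 2 - 1/b = -2s`; the intermediate value theorem then applies on `[b,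
    -- 1]`.
    set b : ℝ := 1 / (2 * s + 2) with hb
    have hb0 : 0 < b := by positivity
    have hb1 : b ≤ 1 := by rw [hb, div_le_one (by positivity)]; linarith
    have hc : ContinuousOn psi1 (Set.Icc b 1) := fun x hx =>
      (hasDerivAt_psi1 (hb0.trans_le hx.1).ne').continuousAt.continuousWithinAt
    have hmem : -(2 * s) ∈ Set.Icc (psi1 b) (psi1 1) := by
      rw [psi1_one]
      refine ⟨?_, by linarith⟩
      have h1 : 1 / b ≤ 1 / b ^ 3 := by
        gcongr
        nlinarith [mul_nonneg hb0.le (sub_nonneg.2 hb1), hb0, sq_nonneg b,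
          mul_nonneg (sq_nonneg b) (sub_nonneg.2 hb1)]
      have h2 : 0 < Real.exp (1 / b - 1) / b ^ 2 := by positivity
      have h3 : 1 / b = 2 * s + 2 := by rw [hb, one_div_one_div]
      unfold psi1
      linarith
    obtain ⟨t, ht, hts⟩ := intermediate_value_Icc hb1 hc hmem
    refine ⟨t, ⟨hb0.trans_le ht.1, ht.2⟩, ?_⟩
    simp only
    rw [deriv_psi (hb0.trans_le ht.1).ne', hts]
    ring
  have h1 := Function.invFunOn_mem key
  have h2 := Function.invFunOn_eq key
  change rho s ∈ Set.Ioc (0 : ℝ) 1 at h1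
  change -(1 / 2) * deriv psi (rho s) = s at h2
  rw [deriv_psi h1.1.ne'] at h2
  exact ⟨h1.1, h1.2, by linarith⟩

/-- Growth of `ψ''` at `rho (2δ)`, the reciprocal of the default step size. -/
lemma psi2_rho_le {d ℓ : ℝ} (hd : 1 ≤ d) (hℓ : 1 + Real.log (2 * Real.sqrt 2 * d + 1) ≤ ℓ) :
    psi2 (rho (2 * d)) ≤ 25 / 2 * d * ℓ ^ 2 := by
  obtain ⟨h0, h1, h2⟩ := rho_spec (s := 2 * d) (by linarith)
  set t := rho (2 * d)
  set u := 1 / t with hu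
  have hu1 : 1 ≤ u := by rw [hu, le_div_iff₀ h0]; linarith
  have e1 : psi1 t = 2 / u - u ^ 3 - Real.exp (u - 1) * u ^ 2 := by
    simp only [psi1, hu]; field_simp
  have e2 : psi2 t = 2 + 3 * u ^ 4 + Real.exp (u - 1) * (u ^ 4 + 2 * u ^ 3) := by
    simp only [psi2, hu]; field_simp
  have hx : u ≤ Real.exp (u - 1) := by have := Real.add_one_le_exp (u - 1); linarith
  set E := Real.exp (u - 1) with hE
  have hiu : 2 / u ≤ 2 := by rw [div_le_iff₀ (by linarith)]; linarith
  have hmain : u ^ 3 + E * u ^ 2 ≤ 4 * d + 2 := by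
    rw [e1] at h2; linarith
  have hs2 : (1.414 : ℝ) ≤ Real.sqrt 2 := by
    apply Real.le_sqrt_of_sq_le; norm_num
  have hEd : E ≤ 2 * Real.sqrt 2 * d + 1 := by
    -- For `u ≤ 2` the bound `E ≤ e` suffices because `d ≥ 1`; for `u ≥ 2` already `4E ≤ Eu² ≤ 4d +
    -- 2`. The constant is just below `2√2`.
    have : E ≤ 2.828 * d + 1 := by
      rcases le_total u 2 with h | h
      · have : E ≤ Real.exp 1 := Real.exp_le_exp.2 (by linarith)
        have := Real.exp_one_lt_d9
        linarith
      · have h4 : 4 ≤ u ^ 2 := by nlinarith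
        have hu3 : 0 ≤ u ^ 3 := by positivity
        nlinarith
    nlinarith
  have huℓ : u ≤ ℓ := by
    have : u - 1 ≤ Real.log (2 * Real.sqrt 2 * d + 1) := by
      rw [Real.le_log_iff_exp_le (by positivity)]; exact hEd
    linarith
  have hℓ2 : 2 ≤ ℓ := by
    have : 1 ≤ Real.log (2 * Real.sqrt 2 * d + 1) := by
      rw [Real.le_log_iff_exp_le (by positivity)]
      have := Real.exp_one_lt_d9
      nlinarith
    linarith
  -- The product `(u² + 2u)(u³ + Eu²)` reproduces the exponential terms of `ψ''` exactly, and `3u⁴ ≤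
  -- u⁵ + 2u⁴` absorbs the rest.
  have hb : psi2 t ≤ 2 + (u ^ 2 + 2 * u) * (4 * d + 2) := by
    have : (u ^ 2 + 2 * u) * (u ^ 3 + E * u ^ 2) ≤ (u ^ 2 + 2 * u) * (4 * d + 2) := by gcongr
    have h4 : u ^ 4 ≤ u ^ 5 := pow_le_pow_right₀ hu1 (by norm_num)
    rw [e2]
    nlinarith
  have hc : u ^ 2 + 2 * u ≤ 2 * ℓ ^ 2 := by nlinarith
  calc psi2 t ≤ 2 + (u ^ 2 + 2 * u) * (4 * d + 2) := hb
    _ ≤ 2 + 2 * ℓ ^ 2 * (4 * d + 2) := by gcongr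
    -- With `d ≥ 1` and `ℓ ≥ 2` the terms are at most `8dℓ²`, `4dℓ²` and `dℓ²/2`.
    _ ≤ 25 / 2 * d * ℓ ^ 2 := by nlinarith [mul_nonneg (sub_nonneg.2 hd) (sq_nonneg ℓ)]

/-! ### Trace inequalities for functions of symmetric matrices. -/

section MatrixFunctions

variable {ι : Type*} [Fintype ι] [DecidableEq ι]

lemma continuousOn_spectrum (f : ℝ → ℝ) (A : Matrix ι ι ℝ) : ContinuousOn f (spectrum ℝ A) :=
  A.finite_real_spectrum.continuousOn f

lemma cfc_fun_id {A : Matrix ι ι ℝ} (hA : A.IsHermitian) : cfc (fun x : ℝ => x) A = A :=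
  cfc_id' ℝ A hA.isSelfAdjoint

lemma cfc_one {A : Matrix ι ι ℝ} (hA : A.IsHermitian) : cfc (fun _ : ℝ => (1 : ℝ)) A = 1 :=
  cfc_const_one ℝ A hA.isSelfAdjoint

lemma cfc_fun_mul (p q : ℝ → ℝ) (A : Matrix ι ι ℝ) :
    cfc (fun x => p x * q x) A = cfc p A * cfc q A :=
  cfc_mul p q A (continuousOn_spectrum p A) (continuousOn_spectrum q A)

lemma cfc_eq_mul {A : Matrix ι ι ℝ} (hA : A.IsHermitian) (f : ℝ → ℝ) :
    cfc f A = (hA.eigenvectorUnitary : Matrix ι ι ℝ) * diagonal (fun i => f (hA.eigenvalues i)) *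
      (hA.eigenvectorUnitary : Matrix ι ι ℝ)ᵀ := by
  rw [hA.cfc_eq, Matrix.IsHermitian.cfc, Unitary.conjStarAlgAut_apply, Matrix.star_eq_conjTranspose,
    conjTranspose_eq_transpose_of_trivial]
  rfl

lemma transpose_eigenvectorUnitary_mul {A : Matrix ι ι ℝ} (hA : A.IsHermitian) :
    (hA.eigenvectorUnitary : Matrix ι ι ℝ)ᵀ * (hA.eigenvectorUnitary : Matrix ι ι ℝ) = 1 := by
  have := Unitary.coe_star_mul_self hA.eigenvectorUnitary
  rwa [Matrix.star_eq_conjTranspose, conjTranspose_eq_transpose_of_trivial] at this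

lemma trace_cfc {A : Matrix ι ι ℝ} (hA : A.IsHermitian) (f : ℝ → ℝ) :
    (cfc f A).trace = ∑ i, f (hA.eigenvalues i) := by
  rw [cfc_eq_mul hA, trace_mul_comm, ← Matrix.mul_assoc, transpose_eigenvectorUnitary_mul,
    Matrix.one_mul, trace_diagonal]

lemma trace_cfc_eq_roots {A : Matrix ι ι ℝ} (hA : A.IsHermitian) (f : ℝ → ℝ) :
    (cfc f A).trace = (A.charpoly.roots.map f).sum := by
  rw [trace_cfc hA, hA.roots_charpoly_eq_eigenvalues]
  simp

lemma trace_cfc_congr {A B : Matrix ι ι ℝ} (hA : A.IsHermitian) (hB : B.IsHermitian)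
    (h : A.charpoly = B.charpoly) (f : ℝ → ℝ) : (cfc f A).trace = (cfc f B).trace := by
  rw [trace_cfc_eq_roots hA, trace_cfc_eq_roots hB, h]

lemma trace_diagonal_sandwich (W : Matrix ι ι ℝ) (a v : ι → ℝ) :
    (diagonal a * W * diagonal v * Wᵀ).trace = ∑ i, ∑ j, W i j ^ 2 * a i * v j := by
  simp only [trace, diag, Matrix.mul_apply (M := _ * _ * _), mul_diagonal, diagonal_mul,
    transpose_apply]
  refine Finset.sum_congr rfl fun i _ => Finset.sum_congr rfl fun j _ => ?_
  ring

/-- Traces of products of functions of two symmetric matrices, in terms of the eigenvalues. -/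
lemma exists_weights {A V : Matrix ι ι ℝ} (hA : A.IsHermitian) (hV : V.IsHermitian) :
    ∃ S : ι → ι → ℝ, (∀ i j, 0 ≤ S i j) ∧ ∀ p q : ℝ → ℝ, (cfc p A * cfc q V).trace =
      ∑ i, ∑ j, S i j * p (hA.eigenvalues i) * q (hV.eigenvalues j) := by
  set U : Matrix ι ι ℝ := (hA.eigenvectorUnitary : Matrix ι ι ℝ) with hU
  set T : Matrix ι ι ℝ := (hV.eigenvectorUnitary : Matrix ι ι ℝ) with hT
  -- The weights are the squared inner products of the eigenvectors of `A` and `V`; they do not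
  -- depend on `p` and `q`.
  refine ⟨fun i j => (Uᵀ * T) i j ^ 2, fun i j => sq_nonneg _, fun p q => ?_⟩
  rw [← trace_diagonal_sandwich, cfc_eq_mul hA, cfc_eq_mul hV, ← hU, ← hT, transpose_mul,
    transpose_transpose, Matrix.mul_assoc U, Matrix.mul_assoc U, trace_mul_comm]
  simp only [Matrix.mul_assoc]

/-- A generalized Klein inequality. -/
lemma klein {A V : Matrix ι ι ℝ} (hA : A.IsHermitian) (hV : V.IsHermitian) {f g : ℝ → ℝ} {k : ℝ}
    (h : ∀ i j, f (hA.eigenvalues i) ≤ f (hV.eigenvalues j) +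
      g (hV.eigenvalues j) * (hA.eigenvalues i - hV.eigenvalues j) +
      k / 2 * (hA.eigenvalues i - hV.eigenvalues j) ^ 2) :
    (cfc f A).trace ≤ (cfc f V).trace + (cfc g V * (A - V)).trace +
      k / 2 * ((A - V) * (A - V)).trace := by
  obtain ⟨S, hS, hpq⟩ := exists_weights hA hV
  have hA1 : cfc (fun _ : ℝ => (1 : ℝ)) A = 1 := cfc_one hA
  have hV1 : cfc (fun _ : ℝ => (1 : ℝ)) V = 1 := cfc_one hV
  have hAi : cfc (fun x : ℝ => x) A = A := cfc_fun_id hA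
  have hVi : cfc (fun x : ℝ => x) V = V := cfc_fun_id hV
  have hA2 : cfc (fun x : ℝ => x * x) A = A * A := by
    rw [cfc_fun_mul, hAi]
  have hV2 : cfc (fun x : ℝ => x * x) V = V * V := by
    rw [cfc_fun_mul, hVi]
  have hgV : cfc (fun x : ℝ => g x * x) V = cfc g V * V := by
    rw [cfc_fun_mul, hVi]
  have e1 := hpq f (fun _ => 1)
  have e2 := hpq (fun _ => 1) f
  have e3 := hpq (fun x => x) g
  have e4 := hpq (fun _ => 1) (fun x => g x * x)
  have e5 := hpq (fun x => x * x) (fun _ => 1)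
  have e6 := hpq (fun x => x) (fun x => x)
  have e7 := hpq (fun _ => 1) (fun x => x * x)
  rw [hV1, Matrix.mul_one] at e1
  rw [hA1, Matrix.one_mul] at e2
  rw [hAi] at e3
  rw [hA1, Matrix.one_mul, hgV] at e4
  rw [hA2, hV1, Matrix.mul_one] at e5
  rw [hAi, hVi] at e6
  rw [hA1, Matrix.one_mul, hV2] at e7
  -- Every term of the scalar inequality is a sum of products `p(a) q(v)`, so its weighted sum turns
  -- into traces.
  have key : ∑ i, ∑ j, S i j * f (hA.eigenvalues i) ≤
      ∑ i, ∑ j, S i j * (f (hV.eigenvalues j) +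
      g (hV.eigenvalues j) * (hA.eigenvalues i - hV.eigenvalues j) +
      k / 2 * (hA.eigenvalues i - hV.eigenvalues j) ^ 2) :=
    Finset.sum_le_sum fun i _ => Finset.sum_le_sum fun j _ =>
      mul_le_mul_of_nonneg_left (h i j) (hS i j)
  have expand : ∑ i, ∑ j, S i j * (f (hV.eigenvalues j) +
      g (hV.eigenvalues j) * (hA.eigenvalues i - hV.eigenvalues j) +
      k / 2 * (hA.eigenvalues i - hV.eigenvalues j) ^ 2) =
      (cfc f V).trace + ((A * cfc g V).trace - (cfc g V * V).trace) +
      k / 2 * ((A * A).trace - 2 * (A * V).trace + (V * V).trace) := by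
    rw [e2, e3, e4, e5, e6, e7]
    simp only [Finset.mul_sum, ← Finset.sum_add_distrib, ← Finset.sum_sub_distrib]
    refine Finset.sum_congr rfl fun i _ => Finset.sum_congr rfl fun j _ => ?_
    ring
  have e0 : (cfc f A).trace = ∑ i, ∑ j, S i j * f (hA.eigenvalues i) := by
    rw [e1]; simp
  rw [e0]
  refine key.trans (le_of_eq ?_)
  rw [expand]
  simp only [Matrix.mul_sub, Matrix.sub_mul, trace_sub]
  rw [trace_mul_comm A (cfc g V), trace_mul_comm V A]
  ring

/-- The Peierls inequality. -/
lemma peierls {C : Matrix ι ι ℝ} (hC : C.IsHermitian) {f : ℝ → ℝ} (hf : ConvexOn ℝ Set.univ f) :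
    ∑ i, f (C i i) ≤ (cfc f C).trace := by
  set U : Matrix ι ι ℝ := (hC.eigenvectorUnitary : Matrix ι ι ℝ) with hU
  have hUU : U * Uᵀ = 1 := mul_eq_one_comm.1 (transpose_eigenvectorUnitary_mul hC)
  have hdiag : ∀ g : ℝ → ℝ, ∀ i, cfc g C i i = ∑ j, U i j ^ 2 * g (hC.eigenvalues j) := by
    intro g i
    rw [cfc_eq_mul hC, ← hU, Matrix.mul_apply]
    simp only [mul_diagonal, transpose_apply]
    exact Finset.sum_congr rfl fun j _ => by ring
  have hrow : ∀ i, ∑ j, U i j ^ 2 = 1 := by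
    intro i
    have := congrFun (congrFun hUU i) i
    simp only [Matrix.mul_apply, transpose_apply, one_apply_eq] at this
    rw [← this]
    exact Finset.sum_congr rfl fun j _ => by ring
  refine Finset.sum_le_sum fun i _ => ?_
  change f (C i i) ≤ cfc f C i i
  have hi : C i i = ∑ j, U i j ^ 2 * hC.eigenvalues j := by
    rw [← hdiag (fun x => x) i, cfc_fun_id hC]
  rw [hdiag f i, hi]
  exact hf.map_sum_le (fun j _ => sq_nonneg _) (hrow i) (fun _ _ => Set.mem_univ _)

/-- With `R = √σ`, the matrices `(GR)(GR)ᵀ` and `(GR)ᵀ(GR)` have the same characteristic polynomial,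
and the diagonal entries of the second are the arguments of `f` on the left. The Peierls inequality
does the rest. -/
lemma sum_le_trace_cfc_congr_diagonal {f : ℝ → ℝ} (hf : ConvexOn ℝ Set.univ f) (G : Matrix ι ι ℝ)
    {σ : ι → ℝ} (hσ : ∀ i, 0 ≤ σ i) :
    ∑ i, f (σ i * ∑ k, G k i ^ 2) ≤ (cfc f (G * diagonal σ * Gᵀ)).trace := by
  set R : Matrix ι ι ℝ := diagonal fun i => Real.sqrt (σ i) with hR
  have hRR : R * R = diagonal σ := by
    rw [hR, diagonal_mul_diagonal]
    congr 1; funext i; exact Real.mul_self_sqrt (hσ i)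
  have hRt : Rᵀ = R := diagonal_transpose _
  have h1 : G * diagonal σ * Gᵀ = (G * R) * (G * R)ᵀ := by
    rw [transpose_mul, hRt, ← hRR]; simp only [Matrix.mul_assoc]
  have hH : ((G * R)ᵀ * (G * R)).IsHermitian := by
    have := isHermitian_conjTranspose_mul_self (G * R)
    rwa [conjTranspose_eq_transpose_of_trivial] at this
  have hH' : ((G * R) * (G * R)ᵀ).IsHermitian := by
    have := isHermitian_mul_conjTranspose_self (G * R)
    rwa [conjTranspose_eq_transpose_of_trivial] at this
  rw [h1, trace_cfc_congr hH' hH (charpoly_mul_comm _ _)]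
  refine le_trans (le_of_eq ?_) (peierls hH hf)
  refine Finset.sum_congr rfl fun i _ => ?_
  congr 1
  rw [Matrix.mul_apply, Finset.mul_sum]
  refine Finset.sum_congr rfl fun k _ => ?_
  simp only [transpose_apply, hR, mul_diagonal]
  have := Real.mul_self_sqrt (hσ i)
  linear_combination -(G k i ^ 2) * this

/-- For convex increasing `f` the trace `Tr f` of a positive semidefinite matrix is at most the mean
of its values at two congruent matrices with contragredient congruences. -/
lemma trace_cfc_le_mean {V G F : Matrix ι ι ℝ} (hV : V.PosSemidef) (hGF : Gᵀ * F = 1)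
    {f : ℝ → ℝ} (hf : ConvexOn ℝ Set.univ f) (hmono : MonotoneOn f (Set.Ici 0)) :
    (cfc f V).trace ≤ 1 / 2 * ((cfc f (G * V * Gᵀ)).trace + (cfc f (F * V * Fᵀ)).trace) := by
  have hH := hV.isHermitian
  set U : Matrix ι ι ℝ := (hH.eigenvectorUnitary : Matrix ι ι ℝ) with hU
  set σ := hH.eigenvalues with hσ
  have hσ0 : ∀ i, 0 ≤ σ i := hV.eigenvalues_nonneg
  have hVU : V = U * diagonal σ * Uᵀ := by
    conv_lhs => rw [← cfc_fun_id hH, cfc_eq_mul hH]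
  have hG : G * V * Gᵀ = (G * U) * diagonal σ * (G * U)ᵀ := by
    rw [transpose_mul, hVU]; simp only [Matrix.mul_assoc]
  have hF : F * V * Fᵀ = (F * U) * diagonal σ * (F * U)ᵀ := by
    rw [transpose_mul, hVU]; simp only [Matrix.mul_assoc]
  have hGF' : (G * U)ᵀ * (F * U) = 1 := by
    rw [transpose_mul, Matrix.mul_assoc, ← Matrix.mul_assoc Gᵀ, hGF, Matrix.one_mul]
    exact transpose_eigenvectorUnitary_mul hH
  have h1 := sum_le_trace_cfc_congr_diagonal hf (G * U) hσ0
  have h2 := sum_le_trace_cfc_congr_diagonal hf (F * U) hσ0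
  rw [hG, hF, trace_cfc hH]
  refine le_trans ?_ (mul_le_mul_of_nonneg_left (add_le_add h1 h2) (by norm_num))
  rw [← Finset.sum_add_distrib, Finset.mul_sum]
  refine Finset.sum_le_sum fun i _ => ?_
  change f (σ i) ≤ _
  set a := ∑ k, (G * U) k i ^ 2
  set b := ∑ k, (F * U) k i ^ 2
  -- Corresponding columns of `GU` and `FU` have inner product 1, so their squared norms average to
  -- at least 1.
  have hab : 1 ≤ (a + b) / 2 := by
    have := congrFun (congrFun hGF' i) i
    simp only [Matrix.mul_apply (M := (G * U)ᵀ), transpose_apply, one_apply_eq] at this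
    rw [← this, ← Finset.sum_add_distrib, Finset.sum_div]
    refine Finset.sum_le_sum fun k _ => ?_
    nlinarith [sq_nonneg ((G * U) k i - (F * U) k i)]
  have hle : σ i ≤ (1 / 2 : ℝ) • (σ i * a) + (1 / 2 : ℝ) • (σ i * b) := by
    simp only [smul_eq_mul]
    nlinarith [hσ0 i]
  have h3 := hmono (hσ0 i) ((hσ0 i).trans hle) hle
  have h4 := hf.2 (Set.mem_univ (σ i * a)) (Set.mem_univ (σ i * b))
    (by norm_num : (0 : ℝ) ≤ 1 / 2) (by norm_num : (0 : ℝ) ≤ 1 / 2) (by norm_num)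
  simp only [smul_eq_mul] at h3 h4
  linarith

lemma cfc_inv_eq {A : Matrix ι ι ℝ} (hA : A.PosDef) : cfc (fun x : ℝ => x⁻¹) A = A⁻¹ := by
  symm
  refine Matrix.inv_eq_right_inv ?_
  have h1 : cfc (fun _ : ℝ => (1 : ℝ)) A = 1 := cfc_one hA.isHermitian
  have hi : cfc (fun x : ℝ => x) A = A := cfc_fun_id hA.isHermitian
  have hm : cfc (fun x : ℝ => x * x⁻¹) A = A * cfc (fun x : ℝ => x⁻¹) A := by
    rw [cfc_fun_mul, hi]
  rw [← hm, ← h1]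
  refine cfc_congr fun x hx => ?_
  rw [hA.isHermitian.spectrum_real_eq_range_eigenvalues] at hx
  obtain ⟨i, rfl⟩ := hx
  exact mul_inv_cancel₀ (hA.eigenvalues_pos i).ne'

lemma posDef_congr {A G F : Matrix ι ι ℝ} (hA : A.PosDef) (hGF : Gᵀ * F = 1) :
    (G * A * Gᵀ).PosDef := by
  have hu : IsUnit Gᵀ := IsUnit.of_mul_eq_one _ hGF
  have := hA.mul_mul_conjTranspose_same (B := G) ?_
  · rwa [conjTranspose_eq_transpose_of_trivial] at this
  · exact vecMul_injective_of_isUnit (by rwa [isUnit_transpose] at hu)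

lemma inv_congr {A G F : Matrix ι ι ℝ} (hA : A.PosDef) (hGF : Gᵀ * F = 1) :
    (G * A * Gᵀ)⁻¹ = F * A⁻¹ * Fᵀ := by
  refine Matrix.inv_eq_right_inv ?_
  have h1 : A * A⁻¹ = 1 := mul_nonsing_inv _ ((isUnit_iff_isUnit_det _).1 hA.isUnit)
  have h2 : G * Fᵀ = 1 := by
    have : (Gᵀ * F)ᵀ = 1 := by rw [hGF, transpose_one]
    rw [transpose_mul, transpose_transpose] at this
    exact mul_eq_one_comm.1 this
  calc G * A * Gᵀ * (F * A⁻¹ * Fᵀ) = G * (A * ((Gᵀ * F) * (A⁻¹ * Fᵀ))) := by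
        simp only [Matrix.mul_assoc]
    _ = G * ((A * A⁻¹) * Fᵀ) := by rw [hGF, Matrix.one_mul, Matrix.mul_assoc]
    _ = 1 := by rw [h1, Matrix.one_mul, h2]

end MatrixFunctions

/-! ### Splitting the kernel; convexity of the barrier under scaling. -/

/-- The part of the kernel function that is convex and increasing in the inverse variable. -/
noncomputable def psiInv (s : ℝ) : ℝ := s ^ 2 / 2 + Real.exp (s - 1)

lemma convexOn_psiInv : ConvexOn ℝ Set.univ psiInv := by
  have h1 : ConvexOn ℝ Set.univ (fun s : ℝ => s ^ 2 / 2) := by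
    have := (Even.convexOn_pow (𝕜 := ℝ) (n := 2) (by decide)).smul
      (show (0 : ℝ) ≤ 1 / 2 by norm_num)
    refine this.congr fun s _ => ?_
    simp only [smul_eq_mul]; ring
  have h2 : ConvexOn ℝ Set.univ (fun s : ℝ => Real.exp (s - 1)) := by
    have := (convexOn_exp.smul (Real.exp_pos (-1)).le)
    refine this.congr fun s _ => ?_
    simp only [smul_eq_mul]
    rw [← Real.exp_add]; congr 1; ring
  exact h1.add h2

lemma monotoneOn_psiInv : MonotoneOn psiInv (Set.Ici 0) := by
  intro a ha b _ hab
  have : (0 : ℝ) ≤ a := ha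
  unfold psiInv
  gcongr

lemma psi_eq {t : ℝ} (ht : t ≠ 0) : psi t = t * t - 5 / 2 + psiInv t⁻¹ := by
  unfold psi psiInv
  rw [one_div t]
  field_simp
  ring

lemma trace_mul_self_nonneg {ι : Type*} [Fintype ι] {A : Matrix ι ι ℝ} (hA : A.IsHermitian) :
    0 ≤ (A * A).trace := by
  have := (posSemidef_conjTranspose_mul_self A).trace_nonneg
  rwa [hA.eq] at this

lemma two_mul_trace_mul_le {ι : Type*} [Fintype ι] {A B : Matrix ι ι ℝ}
    (hA : A.IsHermitian) (hB : B.IsHermitian) :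
    2 * (A * B).trace ≤ (A * A).trace + (B * B).trace := by
  have := trace_mul_self_nonneg (hA.sub hB)
  simp only [Matrix.sub_mul, Matrix.mul_sub, trace_sub] at this
  rw [trace_mul_comm B A] at this
  linarith

section Trace

variable {ι : Type*} [Fintype ι] [DecidableEq ι]

lemma trace_psi_eq {A : Matrix ι ι ℝ} (hA : A.PosDef) :
    (cfc psi A).trace = (A * A).trace - ∑ _i : ι, (5 / 2 : ℝ) + (cfc psiInv A⁻¹).trace := by
  have h1 : cfc psiInv A⁻¹ = cfc (fun x => psiInv x⁻¹) A := by
    rw [← cfc_inv_eq hA]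
    exact (cfc_comp' psiInv (fun x : ℝ => x⁻¹) A
      ((A.finite_real_spectrum.image _).continuousOn _) (continuousOn_spectrum _ A)
      hA.isHermitian.isSelfAdjoint).symm
  have h2 : A * A = cfc (fun x : ℝ => x * x) A := by
    rw [cfc_fun_mul, cfc_fun_id hA.isHermitian]
  rw [h1, h2, trace_cfc hA.isHermitian, trace_cfc hA.isHermitian, trace_cfc hA.isHermitian,
    ← Finset.sum_sub_distrib, ← Finset.sum_add_distrib]
  exact Finset.sum_congr rfl fun i _ => psi_eq (hA.eigenvalues_pos i).ne'

/-- Convexity of the barrier along the geodesic given by two contragredient congruences. -/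
lemma trace_psi_le_mean {V G F : Matrix ι ι ℝ} (hV : V.PosDef) (hGF : Gᵀ * F = 1) :
    (cfc psi V).trace ≤ 1 / 2 * ((cfc psi (G * V * Gᵀ)).trace + (cfc psi (F * V * Fᵀ)).trace) := by
  have hFG : Fᵀ * G = 1 := by
    have : (Gᵀ * F)ᵀ = 1 := by rw [hGF, transpose_one]
    rwa [transpose_mul, transpose_transpose] at this
  have hA := posDef_congr hV hGF
  have hB := posDef_congr hV hFG
  have h1 := trace_cfc_le_mean hV.inv.posSemidef hFG convexOn_psiInv monotoneOn_psiInv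
  have h2 := two_mul_trace_mul_le hA.isHermitian hB.isHermitian
  -- The contragredient factors cancel in the cross term, so `Tr V²` is at most the mean of the two
  -- squared norms.
  have h3 : (G * V * Gᵀ * (F * V * Fᵀ)).trace = (V * V).trace := by
    calc (G * V * Gᵀ * (F * V * Fᵀ)).trace = (G * (V * ((Gᵀ * F) * (V * Fᵀ)))).trace := by
          simp only [Matrix.mul_assoc]
      _ = (V * V * (Fᵀ * G)).trace := by
          rw [hGF, Matrix.one_mul, trace_mul_comm]; simp only [Matrix.mul_assoc]
      _ = (V * V).trace := by rw [hFG, Matrix.mul_one]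
  rw [trace_psi_eq hV, trace_psi_eq hA, trace_psi_eq hB, inv_congr hV hGF, inv_congr hV hFG]
  linarith

lemma posDef_cfc {A : Matrix ι ι ℝ} (hA : A.IsHermitian) {f : ℝ → ℝ}
    (hf : ∀ i, 0 < f (hA.eigenvalues i)) : (cfc f A).PosDef := by
  rw [cfc_eq_mul hA]
  exact posDef_congr (PosDef.diagonal hf) (transpose_eigenvectorUnitary_mul hA)

lemma posDef_sqrt {A : Matrix ι ι ℝ} (hA : A.PosDef) : (cfc Real.sqrt A).PosDef :=
  posDef_cfc hA.isHermitian fun i => Real.sqrt_pos.2 (hA.eigenvalues_pos i)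

lemma cfc_congr_of_posDef {A : Matrix ι ι ℝ} (hA : A.PosDef) {f g : ℝ → ℝ}
    (h : ∀ x, 0 < x → f x = g x) : cfc f A = cfc g A := by
  refine cfc_congr fun x hx => ?_
  rw [hA.isHermitian.spectrum_real_eq_range_eigenvalues] at hx
  obtain ⟨i, rfl⟩ := hx
  exact h _ (hA.eigenvalues_pos i)

lemma sqrt_mul_sqrt {A : Matrix ι ι ℝ} (hA : A.PosDef) :
    cfc Real.sqrt A * cfc Real.sqrt A = A := by
  rw [← cfc_fun_mul]
  conv_rhs => rw [← cfc_fun_id hA.isHermitian]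
  exact cfc_congr_of_posDef hA fun x hx => Real.mul_self_sqrt hx.le

lemma rsqrt_mul_mul_rsqrt {A : Matrix ι ι ℝ} (hA : A.PosDef) :
    cfc (fun t => 1 / Real.sqrt t) A * A * cfc (fun t => 1 / Real.sqrt t) A = 1 := by
  have h : cfc (fun t => 1 / Real.sqrt t * t * (1 / Real.sqrt t)) A =
      cfc (fun t => 1 / Real.sqrt t) A * A * cfc (fun t => 1 / Real.sqrt t) A := by
    rw [cfc_fun_mul (fun t => 1 / Real.sqrt t * t), cfc_fun_mul, cfc_fun_id hA.isHermitian]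
  rw [← h, ← cfc_one hA.isHermitian]
  refine cfc_congr_of_posDef hA fun x hx => ?_
  have h0 := (Real.sqrt_pos.2 hx).ne'
  have := Real.mul_self_sqrt hx.le
  field_simp
  linarith

end Trace

/-! ### Nesterov–Todd scaling. -/

section NesterovTodd

variable {n : ℕ}

lemma isHermitian_coe (Z : SymMat n) : (Z : Matrix (Fin n) (Fin n) ℝ).IsHermitian := Z.2

lemma transpose_eq_of_posDef {A : Matrix (Fin n) (Fin n) ℝ} (hA : A.PosDef) : Aᵀ = A := by
  have := hA.isHermitian.eq
  rwa [conjTranspose_eq_transpose_of_trivial] at this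

lemma coe_congruence (D : Matrix (Fin n) (Fin n) ℝ) (Z : SymMat n) :
    (congruence D Z : Matrix (Fin n) (Fin n) ℝ) = D * Z * Dᵀ := rfl

lemma coe_matFun (f : ℝ → ℝ) (Z : SymMat n) :
    (matFun f Z : Matrix (Fin n) (Fin n) ℝ) = cfc f (Z : Matrix (Fin n) (Fin n) ℝ) := rfl

lemma mul_inv_of_posDef {A : Matrix (Fin n) (Fin n) ℝ} (hA : A.PosDef) : A * A⁻¹ = 1 :=
  mul_nonsing_inv _ ((isUnit_iff_isUnit_det _).1 hA.isUnit)

lemma inv_mul_of_posDef {A : Matrix (Fin n) (Fin n) ℝ} (hA : A.PosDef) : A⁻¹ * A = 1 :=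
  nonsing_inv_mul _ ((isUnit_iff_isUnit_det _).1 hA.isUnit)

lemma posDef_conj {A D : Matrix (Fin n) (Fin n) ℝ} (hA : A.PosDef) (hD : D.PosDef) :
    (D * A * D).PosDef := by
  have := posDef_congr (G := D) (F := D⁻¹) hA
    (by rw [transpose_eq_of_posDef hD, mul_inv_of_posDef hD])
  rwa [transpose_eq_of_posDef hD] at this

/-- Positive definiteness and `PYP = X` are all that is used of the explicit formula for `P`. -/
lemma ntP_spec {X Y : SymMat n} (hX : (X : Matrix (Fin n) (Fin n) ℝ).PosDef)
    (hY : (Y : Matrix (Fin n) (Fin n) ℝ).PosDef) :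
    (ntP X Y : Matrix (Fin n) (Fin n) ℝ).PosDef ∧
      (ntP X Y : Matrix (Fin n) (Fin n) ℝ) * Y * (ntP X Y : Matrix (Fin n) (Fin n) ℝ) = X := by
  have hS := posDef_sqrt hX
  have hSS := sqrt_mul_sqrt hX
  have hM := posDef_conj hY hS
  have hN : (cfc (fun t => 1 / Real.sqrt t)
      (cfc Real.sqrt (X : Matrix (Fin n) (Fin n) ℝ) * Y * cfc Real.sqrt (X :
        Matrix (Fin n) (Fin n) ℝ))).PosDef :=
    posDef_cfc hM.isHermitian fun i => one_div_pos.2 (Real.sqrt_pos.2 (hM.eigenvalues_pos i))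
  have hNMN := rsqrt_mul_mul_rsqrt hM
  have hP : (ntP X Y : Matrix (Fin n) (Fin n) ℝ) = cfc Real.sqrt (X : Matrix (Fin n) (Fin n) ℝ) *
      cfc (fun t => 1 / Real.sqrt t)
        (cfc Real.sqrt (X : Matrix (Fin n) (Fin n) ℝ) * Y *
          cfc Real.sqrt (X : Matrix (Fin n) (Fin n) ℝ)) *
      cfc Real.sqrt (X : Matrix (Fin n) (Fin n) ℝ) := by
    simp only [ntP, coe_congruence, coe_matFun]
    rw [transpose_eq_of_posDef hS]
  rw [hP]
  set S := cfc Real.sqrt (X : Matrix (Fin n) (Fin n) ℝ)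
  set N := cfc (fun t => 1 / Real.sqrt t) (S * Y * S)
  refine ⟨posDef_conj hN hS, ?_⟩
  calc S * N * S * Y * (S * N * S) = S * (N * (S * Y * S) * N) * S := by
        simp only [Matrix.mul_assoc]
    _ = X := by rw [hNMN, Matrix.mul_one, hSS]

lemma posDef_ntD {X Y : SymMat n} (hX : (X : Matrix (Fin n) (Fin n) ℝ).PosDef)
    (hY : (Y : Matrix (Fin n) (Fin n) ℝ).PosDef) : (ntD X Y).PosDef :=
  posDef_sqrt (ntP_spec hX hY).1

lemma conj_inv_cancel {A D : Matrix (Fin n) (Fin n) ℝ} (hD : D.PosDef) :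
    D * (D⁻¹ * A * D⁻¹) * D = A := by
  calc D * (D⁻¹ * A * D⁻¹) * D = (D * D⁻¹) * A * (D⁻¹ * D) := by simp only [Matrix.mul_assoc]
    _ = A := by rw [mul_inv_of_posDef hD, inv_mul_of_posDef hD, Matrix.one_mul, Matrix.mul_one]

lemma inv_conj_cancel {A D : Matrix (Fin n) (Fin n) ℝ} (hD : D.PosDef) :
    D⁻¹ * (D * A * D) * D⁻¹ = A := by
  calc D⁻¹ * (D * A * D) * D⁻¹ = (D⁻¹ * D) * A * (D * D⁻¹) := by simp only [Matrix.mul_assoc]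
    _ = A := by rw [mul_inv_of_posDef hD, inv_mul_of_posDef hD, Matrix.one_mul, Matrix.mul_one]

lemma coe_ntV {X Y : SymMat n} (hX : (X : Matrix (Fin n) (Fin n) ℝ).PosDef)
    (hY : (Y : Matrix (Fin n) (Fin n) ℝ).PosDef) (μ : ℝ) :
    (ntV X Y μ : Matrix (Fin n) (Fin n) ℝ) =
      (1 / Real.sqrt μ) • ((ntD X Y)⁻¹ * (X : Matrix (Fin n) (Fin n) ℝ) * (ntD X Y)⁻¹) := by
  simp only [ntV, Submodule.coe_smul, coe_congruence]
  rw [transpose_eq_of_posDef (posDef_ntD hX hY).inv]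

/-- The Nesterov–Todd scaling maps `X` and `Y` to the same positive definite matrix. -/
lemma nt_spec {X Y : SymMat n} (hX : (X : Matrix (Fin n) (Fin n) ℝ).PosDef)
    (hY : (Y : Matrix (Fin n) (Fin n) ℝ).PosDef) {μ : ℝ} (hμ : 0 < μ) :
    (ntV X Y μ : Matrix (Fin n) (Fin n) ℝ).PosDef ∧
      (X : Matrix (Fin n) (Fin n) ℝ) = Real.sqrt μ • (ntD X Y * ntV X Y μ * ntD X Y) ∧
      (Y : Matrix (Fin n) (Fin n) ℝ) = Real.sqrt μ • ((ntD X Y)⁻¹ * ntV X Y μ * (ntD X Y)⁻¹) := by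
  have hD := posDef_ntD hX hY
  obtain ⟨hP, hPY⟩ := ntP_spec hX hY
  have hDD : ntD X Y * ntD X Y = ntP X Y := sqrt_mul_sqrt hP
  have hs := Real.sqrt_pos.2 hμ
  rw [coe_ntV hX hY]
  set D := ntD X Y
  rw [← hDD] at hPY
  have hinv : D⁻¹ * (X : Matrix (Fin n) (Fin n) ℝ) * D⁻¹ = D * Y * D := by
    conv_lhs => rw [← hPY]
    calc D⁻¹ * (D * D * Y * (D * D)) * D⁻¹ = (D⁻¹ * D) * (D * Y * D) * (D * D⁻¹) := by
          simp only [Matrix.mul_assoc]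
      _ = D * Y * D := by
          rw [mul_inv_of_posDef hD, inv_mul_of_posDef hD, Matrix.one_mul, Matrix.mul_one]
  refine ⟨(posDef_conj hX hD.inv).smul (one_div_pos.2 hs), ?_, ?_⟩
  · rw [Matrix.mul_smul, Matrix.smul_mul, smul_smul, mul_one_div_cancel hs.ne', one_smul,
      conj_inv_cancel hD]
  · rw [Matrix.mul_smul, Matrix.smul_mul, smul_smul, mul_one_div_cancel hs.ne', one_smul, hinv,
      inv_conj_cancel hD]

/-- The barrier after a step is at most the mean of the barriers of the two scaled iterates. -/
lemma barrier_ntV_le_mean {X Y : SymMat n} {D A B : Matrix (Fin n) (Fin n) ℝ} {μ : ℝ} (hμ : 0 < μ)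
    (hD : D.PosDef) (hA : A.PosDef) (hB : B.PosDef)
    (hX : (X : Matrix (Fin n) (Fin n) ℝ) = Real.sqrt μ • (D * A * D))
    (hY : (Y : Matrix (Fin n) (Fin n) ℝ) = Real.sqrt μ • (D⁻¹ * B * D⁻¹)) :
    barrier (ntV X Y μ) ≤ 1 / 2 * ((cfc psi A).trace + (cfc psi B).trace) := by
  have hs := Real.sqrt_pos.2 hμ
  have hX' : (X : Matrix (Fin n) (Fin n) ℝ).PosDef := by
    rw [hX]; exact (posDef_conj hA hD).smul hs
  have hY' : (Y : Matrix (Fin n) (Fin n) ℝ).PosDef := by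
    rw [hY]; exact (posDef_conj hB hD.inv).smul hs
  obtain ⟨hV, hXV, hYV⟩ := nt_spec hX' hY' hμ
  have hE := posDef_ntD hX' hY'
  set E := ntD X Y
  set V : Matrix (Fin n) (Fin n) ℝ := (ntV X Y μ : Matrix (Fin n) (Fin n) ℝ) with hVdef
  have hDA : D * A * D = E * V * E := smul_right_injective _ hs.ne' (hX.symm.trans hXV)
  have hDB : D⁻¹ * B * D⁻¹ = E⁻¹ * V * E⁻¹ := smul_right_injective _ hs.ne' (hY.symm.trans hYV)
  have hDt := transpose_eq_of_posDef hD
  have hDit := transpose_eq_of_posDef hD.inv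
  have hEt := transpose_eq_of_posDef hE
  have hEit := transpose_eq_of_posDef hE.inv
  -- Passing from the old scaling `D` to the new scaling `E` transforms the two scaled iterates by
  -- contragredient congruences.
  have hGF : (D⁻¹ * E)ᵀ * (D * E⁻¹) = 1 := by
    rw [transpose_mul, hEt, hDit]
    calc E * D⁻¹ * (D * E⁻¹) = E * (D⁻¹ * D) * E⁻¹ := by simp only [Matrix.mul_assoc]
      _ = 1 := by rw [inv_mul_of_posDef hD, Matrix.mul_one, mul_inv_of_posDef hE]
  have h := trace_psi_le_mean hV hGF
  have hA' : D⁻¹ * E * V * (D⁻¹ * E)ᵀ = A := by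
    rw [transpose_mul, hEt, hDit]
    calc D⁻¹ * E * V * (E * D⁻¹) = D⁻¹ * (E * V * E) * D⁻¹ := by simp only [Matrix.mul_assoc]
      _ = A := by rw [← hDA, inv_conj_cancel hD]
  have hB' : D * E⁻¹ * V * (D * E⁻¹)ᵀ = B := by
    rw [transpose_mul, hEit, hDt]
    calc D * E⁻¹ * V * (E⁻¹ * D) = D * (E⁻¹ * V * E⁻¹) * D := by simp only [Matrix.mul_assoc]
      _ = B := by rw [← hDB, conj_inv_cancel hD]
  rw [hA', hB'] at h
  exact h

end NesterovTodd

/-! ### Decrease of the barrier along the scaled directions. -/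

section Decrease

variable {ι : Type*} [Fintype ι] [DecidableEq ι]

lemma posSemidef_cfc_iff {A : Matrix ι ι ℝ} (hA : A.IsHermitian) {f : ℝ → ℝ} :
    (cfc f A).PosSemidef ↔ ∀ i, 0 ≤ f (hA.eigenvalues i) := by
  rw [cfc_eq_mul hA]
  set U : Matrix ι ι ℝ := (hA.eigenvectorUnitary : Matrix ι ι ℝ) with hU
  have hUU : Uᵀ * U = 1 := transpose_eigenvectorUnitary_mul hA
  constructor
  · intro h
    have h1 := h.conjTranspose_mul_mul_same U
    rw [conjTranspose_eq_transpose_of_trivial] at h1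
    have h2 : Uᵀ * (U * diagonal (fun i => f (hA.eigenvalues i)) * Uᵀ) * U =
        diagonal (fun i => f (hA.eigenvalues i)) := by
      calc _ = (Uᵀ * U) * diagonal (fun i => f (hA.eigenvalues i)) * (Uᵀ * U) := by
            simp only [Matrix.mul_assoc]
        _ = _ := by rw [hUU, Matrix.one_mul, Matrix.mul_one]
    rw [h2] at h1
    exact posSemidef_diagonal_iff.1 h1
  · intro h
    have h1 := (PosSemidef.diagonal h).mul_mul_conjTranspose_same U
    rwa [conjTranspose_eq_transpose_of_trivial] at h1

lemma cfc_add_const {A : Matrix ι ι ℝ} (hA : A.IsHermitian) (c : ℝ) :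
    cfc (fun x : ℝ => x + c) A = A + c • (1 : Matrix ι ι ℝ) := by
  have h1 : cfc (fun x : ℝ => x + c) A = cfc (fun x : ℝ => x) A + cfc (fun _ : ℝ => c) A :=
    cfc_add A _ _ (continuousOn_spectrum _ A) (continuousOn_spectrum _ A)
  have h2 : cfc (fun _ : ℝ => c) A = algebraMap ℝ (Matrix ι ι ℝ) c :=
    cfc_const c A hA.isSelfAdjoint
  rw [h1, cfc_fun_id hA, h2, Algebra.algebraMap_eq_smul_one]

/-- Spectral lower bounds in terms of the Loewner order. -/
lemma posSemidef_add_smul_one_iff {A : Matrix ι ι ℝ} (hA : A.IsHermitian) (c : ℝ) :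
    (A + c • (1 : Matrix ι ι ℝ)).PosSemidef ↔ ∀ i, 0 ≤ hA.eigenvalues i + c := by
  rw [← cfc_add_const hA, posSemidef_cfc_iff hA]

lemma trace_cfc_mul_cfc {A : Matrix ι ι ℝ} (hA : A.IsHermitian) (f : ℝ → ℝ) :
    (cfc f A * cfc f A).trace = ∑ i, f (hA.eigenvalues i) ^ 2 := by
  rw [← cfc_fun_mul, trace_cfc hA]
  exact Finset.sum_congr rfl fun i _ => (sq _).symm

lemma abs_le_of_trace_le {A : Matrix ι ι ℝ} (hA : A.IsHermitian) (f : ℝ → ℝ) {c : ℝ} (hc : 0 ≤ c)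
    (h : (cfc f A * cfc f A).trace ≤ c ^ 2) (i : ι) : |f (hA.eigenvalues i)| ≤ c := by
  refine abs_le_of_sq_le_sq ?_ hc
  rw [trace_cfc_mul_cfc hA] at h
  exact (Finset.single_le_sum (fun j _ => sq_nonneg (f (hA.eigenvalues j)))
    (Finset.mem_univ i)).trans h

/-- The Frobenius norm dominates every eigenvalue in absolute value. -/
lemma posSemidef_add_of_trace_le {A : Matrix ι ι ℝ} (hA : A.IsHermitian) {c : ℝ} (hc : 0 ≤ c)
    (h : (A * A).trace ≤ c ^ 2) : (A + c • (1 : Matrix ι ι ℝ)).PosSemidef := by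
  rw [posSemidef_add_smul_one_iff hA]
  intro i
  have := abs_le_of_trace_le hA (fun x => x) hc (by rwa [cfc_fun_id hA]) i
  linarith [(abs_le.1 this).1]

/-- Along a direction of length at most `2δ`, the default step keeps all eigenvalues above
`ρ(2δ)`. -/
lemma eigenvalues_step_ge {V Z : Matrix ι ι ℝ} (hV : V.PosDef) (hZ : Z.IsHermitian) {δ r : ℝ}
    (hδ : 0 < δ) (hr : 0 < r) (hrδ : psi1 r = -(4 * δ))
    (hVδ : (cfc psi1 V * cfc psi1 V).trace = 4 * δ ^ 2) (hZδ : (Z * Z).trace ≤ 4 * δ ^ 2)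
    (hA : (V + (1 / psi2 r) • Z).IsHermitian) :
    (∀ i, r ≤ hV.isHermitian.eigenvalues i) ∧ ∀ i, r ≤ hA.eigenvalues i := by
  have hk : 0 < psi2 r := lt_of_lt_of_le two_pos (two_le_psi2 hr)
  set α := 1 / psi2 r with hα
  have hα0 : 0 < α := one_div_pos.2 hk
  have hv : ∀ i, r + 2 * δ * α ≤ hV.isHermitian.eigenvalues i := by
    intro i
    have h1 := abs_le_of_trace_le hV.isHermitian psi1 (c := 2 * δ) (by linarith)
      (by rw [hVδ]; exact le_of_eq (by ring)) i
    have h2 := (abs_le.1 h1).1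
    have h3 : r < hV.isHermitian.eigenvalues i :=
      lt_of_psi1_lt (by rw [hrδ]; linarith) (hV.eigenvalues_pos i)
    have h4 := psi1_upper hr h3.le
    have h5 : 2 * δ / psi2 r ≤ hV.isHermitian.eigenvalues i - r := by
      rw [div_le_iff₀ hk]; nlinarith
    have h6 : 2 * δ * α = 2 * δ / psi2 r := by rw [hα]; ring
    linarith
  refine ⟨fun i => le_trans (by nlinarith [mul_pos hδ hα0]) (hv i), ?_⟩
  have h1 : (V + (-(r + 2 * δ * α)) • (1 : Matrix ι ι ℝ)).PosSemidef :=
    (posSemidef_add_smul_one_iff hV.isHermitian _).2 fun i => by linarith [hv i]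
  have h2 : (Z + (2 * δ) • (1 : Matrix ι ι ℝ)).PosSemidef :=
    posSemidef_add_of_trace_le hZ (by linarith) (hZδ.trans (le_of_eq (by ring)))
  -- Adding Loewner inequalities replaces an eigenvalue perturbation bound.
  have h3 := h1.add (h2.smul hα0.le)
  have h4 : V + (-(r + 2 * δ * α)) • (1 : Matrix ι ι ℝ) + α • (Z + (2 * δ) • (1 : Matrix ι ι ℝ)) =
      (V + α • Z) + (-r) • (1 : Matrix ι ι ℝ) := by
    module
  rw [h4, posSemidef_add_smul_one_iff hA] at h3
  intro i
  linarith [h3 i]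

/-- Decrease of the mean of the barriers along the scaled search directions. -/
lemma mean_trace_psi_step {V S T : Matrix ι ι ℝ} (hV : V.PosDef) (hS : S.IsHermitian)
    (hT : T.IsHermitian) (hST : S + T = -cfc psi1 V) (hmon : 0 ≤ (S * T).trace) {δ r : ℝ}
    (hδ : 0 < δ) (hr : 0 < r) (hrδ : psi1 r = -(4 * δ))
    (hVδ : (cfc psi1 V * cfc psi1 V).trace = 4 * δ ^ 2) :
    (V + (1 / psi2 r) • S).PosDef ∧ (V + (1 / psi2 r) • T).PosDef ∧
      1 / 2 * ((cfc psi (V + (1 / psi2 r) • S)).trace + (cfc psi (V + (1 / psi2 r) • T)).trace) ≤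
        (cfc psi V).trace - 1 / psi2 r * δ ^ 2 := by
  have hk : 0 < psi2 r := lt_of_lt_of_le two_pos (two_le_psi2 hr)
  have hsum : (S * S).trace + (T * T).trace ≤ 4 * δ ^ 2 := by
    have h : ((S + T) * (S + T)).trace = 4 * δ ^ 2 := by
      rw [hST, Matrix.neg_mul, Matrix.mul_neg, neg_neg, hVδ]
    simp only [Matrix.add_mul, Matrix.mul_add, trace_add] at h
    rw [trace_mul_comm T S] at h
    linarith
  have hS0 := trace_mul_self_nonneg hS
  have hT0 := trace_mul_self_nonneg hT
  have hlin : (cfc psi1 V * S).trace + (cfc psi1 V * T).trace = -(4 * δ ^ 2) := by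
    rw [← trace_add, ← Matrix.mul_add, hST, Matrix.mul_neg, trace_neg, hVδ]
  have hsmul : ∀ {Z : Matrix ι ι ℝ}, Z.IsHermitian → (V + (1 / psi2 r) • Z).IsHermitian :=
    fun hZ => hV.isHermitian.add (hZ.smul (IsSelfAdjoint.all _))
  have key : ∀ Z : Matrix ι ι ℝ, Z.IsHermitian → (Z * Z).trace ≤ 4 * δ ^ 2 →
      (V + (1 / psi2 r) • Z).PosDef ∧ (cfc psi (V + (1 / psi2 r) • Z)).trace ≤ (cfc psi V).trace +
        1 / psi2 r * (cfc psi1 V * Z).trace + 1 / (2 * psi2 r) * (Z * Z).trace := by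
    intro Z hZ hZδ
    have hA := hsmul hZ
    obtain ⟨h1, h2⟩ := eigenvalues_step_ge hV hZ hδ hr hrδ hVδ hZδ hA
    refine ⟨hA.posDef_iff_eigenvalues_pos.2 fun i => hr.trans_le (h2 i), ?_⟩
    have h3 := klein hA hV.isHermitian (f := psi) (g := psi1) (k := psi2 r)
      fun i j => psi_upper hr (h1 j) (h2 i)
    simp only [add_sub_cancel_left, Matrix.mul_smul, Matrix.smul_mul, trace_smul, smul_eq_mul] at h3
    refine h3.trans (le_of_eq ?_)
    field_simp
  obtain ⟨hA, hA'⟩ := key S hS (by linarith)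
  obtain ⟨hB, hB'⟩ := key T hT (by linarith)
  refine ⟨hA, hB, ?_⟩
  have e1 : 1 / psi2 r * (cfc psi1 V * S).trace + 1 / psi2 r * (cfc psi1 V * T).trace =
      -(4 * (1 / psi2 r * δ ^ 2)) := by
    rw [← mul_add, hlin]; ring
  -- The choice `α = 1/ψ''(r)` makes the quadratic terms at most half of the linear gain `4αδ²`;
  -- averaging leaves `αδ²`.
  have e2 : 1 / (2 * psi2 r) * (S * S).trace + 1 / (2 * psi2 r) * (T * T).trace ≤
      2 * (1 / psi2 r * δ ^ 2) := by
    rw [← mul_add]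
    calc 1 / (2 * psi2 r) * ((S * S).trace + (T * T).trace) ≤ 1 / (2 * psi2 r) * (4 * δ ^ 2) := by
          gcongr
      _ = 2 * (1 / psi2 r * δ ^ 2) := by field_simp; ring
  linarith

end Decrease

/-! ### The inner iteration. -/

section Inner

variable {n : ℕ}

lemma congruence_add (D : Matrix (Fin n) (Fin n) ℝ) (Z W : SymMat n) :
    congruence D (Z + W) = congruence D Z + congruence D W := by
  apply Subtype.ext
  simp only [coe_congruence, Submodule.coe_add, Matrix.mul_add, Matrix.add_mul]

lemma congruence_smul (D : Matrix (Fin n) (Fin n) ℝ) (c : ℝ) (Z : SymMat n) :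
    congruence D (c • Z) = c • congruence D Z := by
  apply Subtype.ext
  simp only [coe_congruence, Submodule.coe_smul, Matrix.mul_smul, Matrix.smul_mul]

lemma congruence_inv_congruence {D : Matrix (Fin n) (Fin n) ℝ} (hD : D.PosDef) (Z : SymMat n) :
    congruence D⁻¹ (congruence D Z) = Z := by
  apply Subtype.ext
  simp only [coe_congruence]
  rw [transpose_eq_of_posDef hD, transpose_eq_of_posDef hD.inv, inv_conj_cancel hD]

/-- By cyclicity the trace is `Tr(W L(W))` with `W = DZD`. -/
lemma trace_mul_congruence_nonneg {L : SymMat n →ₗ[ℝ] SymMat n} (hL : IsMonotone L)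
    {D : Matrix (Fin n) (Fin n) ℝ} (hD : D.PosDef) (Z : SymMat n) :
    0 ≤ ((Z : Matrix (Fin n) (Fin n) ℝ) *
      (congruence D (L (congruence D Z)) : Matrix (Fin n) (Fin n) ℝ)).trace := by
  have h := hL (congruence D Z)
  rw [coe_congruence D Z] at h
  rw [coe_congruence D (L _)]
  rw [transpose_eq_of_posDef hD] at h ⊢
  refine h.trans (le_of_eq ?_)
  rw [← Matrix.mul_assoc, trace_mul_comm _ D]
  simp only [Matrix.mul_assoc]

/-- The scaled system has exactly one solution. -/
lemma existsUnique_scaledDirection {L : SymMat n →ₗ[ℝ] SymMat n} (hL : IsMonotone L) {s : State n}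
    (hX : (s.X : Matrix (Fin n) (Fin n) ℝ).PosDef) (hY : (s.Y : Matrix (Fin n) (Fin n) ℝ).PosDef) :
    ∃ DX DY, IsScaledDirection L s DX DY ∧
      ∀ DX' DY', IsScaledDirection L s DX' DY' → DX' = DX ∧ DY' = DY := by
  have hD := posDef_ntD hX hY
  let C : SymMat n →ₗ[ℝ] SymMat n :=
    { toFun := congruence (ntD s.X s.Y)
      map_add' := congruence_add _
      map_smul' := congruence_smul _ }
  let T : SymMat n →ₗ[ℝ] SymMat n := LinearMap.id + C ∘ₗ L ∘ₗ C
  have hT : ∀ Z, T Z = Z + congruence (ntD s.X s.Y) (L (congruence (ntD s.X s.Y) Z)) :=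
    fun Z => rfl
  -- On the kernel, monotonicity forces `-Tr Z² ≥ 0`, so `Z = 0`; in finite dimension injectivity
  -- gives surjectivity.
  have hinj : Function.Injective T := by
    rw [injective_iff_map_eq_zero]
    intro Z hZ
    rw [hT] at hZ
    have h1 := trace_mul_congruence_nonneg hL hD Z
    rw [eq_neg_of_add_eq_zero_right hZ, Submodule.coe_neg, Matrix.mul_neg, trace_neg] at h1
    have h2 := trace_mul_self_nonneg (isHermitian_coe Z)
    have h3 : ((Z : Matrix (Fin n) (Fin n) ℝ)ᴴ * Z).trace = 0 := by
      rw [(isHermitian_coe Z).eq]; linarith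
    exact Subtype.ext (trace_conjTranspose_mul_self_eq_zero_iff.1 h3)
  obtain ⟨DX, hDX⟩ := LinearMap.injective_iff_surjective.1 hinj (-matFun (deriv psi) s.V)
  refine ⟨DX, _, ⟨(hT DX).symm.trans hDX, rfl⟩, ?_⟩
  rintro DX' DY' ⟨h1, rfl⟩
  have : DX' = DX := hinj (by rw [hDX, ← h1, hT])
  subst this
  exact ⟨rfl, rfl⟩

lemma cfc_deriv_psi {V : Matrix (Fin n) (Fin n) ℝ} (hV : V.PosDef) :
    cfc (deriv psi) V = cfc psi1 V :=
  cfc_congr_of_posDef hV fun _ hx => deriv_psi hx.ne'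

lemma trace_psi1_sq {V : SymMat n} (hV : (V : Matrix (Fin n) (Fin n) ℝ).PosDef) :
    (cfc psi1 (V : Matrix (Fin n) (Fin n) ℝ) * cfc psi1 (V : Matrix (Fin n) (Fin n) ℝ)).trace =
      4 * delta V ^ 2 := by
  have h : 0 ≤ (cfc psi1 (V : Matrix (Fin n) (Fin n) ℝ) *
      cfc psi1 (V : Matrix (Fin n) (Fin n) ℝ)).trace := by
    rw [trace_cfc_mul_cfc hV.isHermitian]
    exact Finset.sum_nonneg fun i _ => sq_nonneg _
  simp only [delta, coe_matFun]
  rw [cfc_deriv_psi hV, mul_pow, Real.sq_sqrt h]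
  ring

lemma delta_nonneg (V : SymMat n) : 0 ≤ delta V :=
  mul_nonneg (by norm_num) (Real.sqrt_nonneg _)

lemma barrier_eq_sum {V : SymMat n} (hV : (V : Matrix (Fin n) (Fin n) ℝ).PosDef) :
    barrier V = ∑ i, psi (hV.isHermitian.eigenvalues i) :=
  trace_cfc hV.isHermitian psi

lemma sqrt_barrier_le_delta {V : SymMat n} (hV : (V : Matrix (Fin n) (Fin n) ℝ).PosDef) :
    Real.sqrt (barrier V) ≤ delta V := by
  refine Real.sqrt_le_iff.2 ⟨delta_nonneg V, ?_⟩
  have h := trace_psi1_sq hV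
  rw [trace_cfc_mul_cfc hV.isHermitian] at h
  have h2 : 4 * barrier V ≤ 4 * delta V ^ 2 := by
    rw [← h, barrier_eq_sum hV, Finset.mul_sum]
    exact Finset.sum_le_sum fun i _ => psi_le_psi1_sq (hV.eigenvalues_pos i)
  linarith

/-- The function `δ ↦ δ / (1 + log (aδ + 1))²` is increasing where the logarithm is at least `1`. -/
lemma div_log_sq_mono {a x y : ℝ} (ha : 0 < a) (hx : 0 < x) (hxy : x ≤ y)
    (hl : 1 ≤ Real.log (a * x + 1)) :
    x * (1 + Real.log (a * y + 1)) ^ 2 ≤ y * (1 + Real.log (a * x + 1)) ^ 2 := by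
  have hy : 0 < y := hx.trans_le hxy
  set z := Real.sqrt (y / x) with hz
  have hz0 : 0 < z := Real.sqrt_pos.2 (div_pos hy hx)
  have hz1 : 1 ≤ z := by
    rw [hz, Real.one_le_sqrt, one_le_div hx]; exact hxy
  have hzz : z ^ 2 * x = y := by
    rw [hz, Real.sq_sqrt (div_pos hy hx).le, div_mul_cancel₀ _ hx.ne']
  have h1 : Real.log (a * y + 1) ≤ Real.log (a * x + 1) + 2 * Real.log z := by
    have h2 : (2 : ℝ) * Real.log z = Real.log (z ^ 2) := by rw [Real.log_pow]; norm_num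
    rw [h2, ← Real.log_mul (by positivity) (by positivity)]
    apply Real.log_le_log (by positivity)
    nlinarith
  have h2 := Real.log_le_sub_one_of_pos hz0
  have h3 : 0 ≤ Real.log (a * y + 1) := Real.log_nonneg (by nlinarith [mul_pos ha hy])
  -- Uses `2 log z ≤ 2(z - 1)`; the factor 2 is absorbed because `1 + log(ax + 1) ≥ 2`.
  have h4 : 1 + Real.log (a * y + 1) ≤ z * (1 + Real.log (a * x + 1)) := by nlinarith
  calc x * (1 + Real.log (a * y + 1)) ^ 2 ≤ x * (z * (1 + Real.log (a * x + 1))) ^ 2 := by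
        gcongr
    _ = y * (1 + Real.log (a * x + 1)) ^ 2 := by rw [← hzz]; ring

/-- The decrease guaranteed by the default step, in terms of the barrier value. -/
lemma decrease_ge {δ b B : ℝ} (hb : 1 ≤ b) (hbB : b ≤ B) (hbδ : Real.sqrt b ≤ δ) :
    2 * Real.sqrt b / (25 * (1 + Real.log (2 * Real.sqrt (2 * B) + 1)) ^ 2) ≤
      1 / psi2 (rho (2 * δ)) * δ ^ 2 := by
  have hs : 1 ≤ Real.sqrt b := Real.one_le_sqrt.2 hb
  have hδ : 1 ≤ δ := hs.trans hbδ
  have ha : (2.8 : ℝ) ≤ 2 * Real.sqrt 2 := by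
    have : (1.4 : ℝ) ≤ Real.sqrt 2 := by apply Real.le_sqrt_of_sq_le; norm_num
    linarith
  have hl : 1 ≤ Real.log (2 * Real.sqrt 2 * Real.sqrt b + 1) := by
    rw [Real.le_log_iff_exp_le (by positivity)]
    have := Real.exp_one_lt_d9
    nlinarith
  have h1 := psi2_rho_le hδ le_rfl
  have h2 := div_log_sq_mono (a := 2 * Real.sqrt 2) (by linarith) (by linarith) hbδ hl
  have hlB : Real.log (2 * Real.sqrt 2 * Real.sqrt b + 1) ≤
      Real.log (2 * Real.sqrt (2 * B) + 1) := by
    apply Real.log_le_log (by positivity)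
    rw [Real.sqrt_mul (by norm_num)]
    have := Real.sqrt_le_sqrt hbB
    nlinarith
  have hk : 0 < psi2 (rho (2 * δ)) :=
    lt_of_lt_of_le two_pos (two_le_psi2 (rho_spec (by linarith)).1)
  set ℓδ := 1 + Real.log (2 * Real.sqrt 2 * δ + 1)
  set ℓb := 1 + Real.log (2 * Real.sqrt 2 * Real.sqrt b + 1) with hℓb
  set ℓB := 1 + Real.log (2 * Real.sqrt (2 * B) + 1) with hℓB
  have hℓ : 2 ≤ ℓb := by linarith
  have hℓ' : ℓb ^ 2 ≤ ℓB ^ 2 := pow_le_pow_left₀ (by linarith) (by linarith) 2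
  have h25 : 0 < 25 * ℓB ^ 2 := by nlinarith
  rw [div_le_iff₀ h25, div_mul_eq_mul_div, div_mul_eq_mul_div, le_div_iff₀ hk, one_mul]
  calc 2 * Real.sqrt b * psi2 (rho (2 * δ)) ≤ 2 * Real.sqrt b * (25 / 2 * δ * ℓδ ^ 2) := by
        gcongr
    _ = 25 * δ * (Real.sqrt b * ℓδ ^ 2) := by ring
    _ ≤ 25 * δ * (δ * ℓb ^ 2) := by gcongr
    _ ≤ 25 * δ * (δ * ℓB ^ 2) := by gcongr
    _ = δ ^ 2 * (25 * ℓB ^ 2) := by ring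

/-- One inner iteration: feasibility is kept and the barrier decreases. -/
lemma inner_step {L : SymMat n →ₗ[ℝ] SymMat n} (hL : IsMonotone L) {Q : SymMat n} {τ : ℝ}
    (hτ : 1 ≤ τ) {s s' : State n} (hs : StrictlyFeasible L Q s.X s.Y) (hμ : 0 < s.μ)
    (h : InnerStep L τ s s') :
    StrictlyFeasible L Q s'.X s'.Y ∧
      s'.Psi ≤ s.Psi - 1 / psi2 (rho (2 * delta s.V)) * delta s.V ^ 2 := by
  obtain ⟨hτs, S, T, ⟨hST, hT⟩, hX', hY', hμ'⟩ := h
  obtain ⟨hYX, hX, hY⟩ := hs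
  obtain ⟨hV, hXV, hYV⟩ := nt_spec hX hY hμ
  change (s.V : Matrix (Fin n) (Fin n) ℝ).PosDef at hV
  have hD := posDef_ntD hX hY
  have hδ1 : 1 ≤ delta s.V :=
    le_trans (Real.one_le_sqrt.2 (hτ.trans hτs.le)) (sqrt_barrier_le_delta hV)
  obtain ⟨hr, -, hrδ⟩ := rho_spec (s := 2 * delta s.V) (by linarith)
  have hstep : stepSize s.V = 1 / psi2 (rho (2 * delta s.V)) := by
    rw [stepSize, deriv_deriv_psi hr.ne']
  have hST' : (S : Matrix (Fin n) (Fin n) ℝ) + T =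
      -cfc psi1 (s.V : Matrix (Fin n) (Fin n) ℝ) := by
    rw [← cfc_deriv_psi hV, ← coe_matFun, ← Submodule.coe_neg, ← hST, Submodule.coe_add]
  have hmon : 0 ≤ ((S : Matrix (Fin n) (Fin n) ℝ) * (T : Matrix (Fin n) (Fin n) ℝ)).trace := by
    rw [← hT]; exact trace_mul_congruence_nonneg hL hD S
  obtain ⟨hA, hB, hdec⟩ := mean_trace_psi_step hV (isHermitian_coe S) (isHermitian_coe T) hST'
    hmon (by linarith) hr (by rw [hrδ]; ring) (trace_psi1_sq hV)
  rw [← hstep] at hA hB hdec ⊢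
  have hs := Real.sqrt_pos.2 hμ
  have hXm : (s'.X : Matrix (Fin n) (Fin n) ℝ) = Real.sqrt s.μ • (ntD s.X s.Y *
      ((s.V : Matrix (Fin n) (Fin n) ℝ) + stepSize s.V • (S : Matrix (Fin n) (Fin n) ℝ)) *
      ntD s.X s.Y) := by
    rw [hX', Submodule.coe_add, Submodule.coe_smul, Submodule.coe_smul, coe_congruence,
      transpose_eq_of_posDef hD]
    conv_lhs => enter [1]; rw [hXV]
    simp only [Matrix.mul_add, Matrix.add_mul, Matrix.mul_smul, Matrix.smul_mul, smul_add]
    rw [smul_comm (stepSize s.V)]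
    rfl
  have hYm : (s'.Y : Matrix (Fin n) (Fin n) ℝ) = Real.sqrt s.μ • ((ntD s.X s.Y)⁻¹ *
      ((s.V : Matrix (Fin n) (Fin n) ℝ) + stepSize s.V • (T : Matrix (Fin n) (Fin n) ℝ)) *
      (ntD s.X s.Y)⁻¹) := by
    rw [hY', Submodule.coe_add, Submodule.coe_smul, Submodule.coe_smul, coe_congruence,
      transpose_eq_of_posDef hD.inv]
    conv_lhs => enter [1]; rw [hYV]
    simp only [Matrix.mul_add, Matrix.add_mul, Matrix.mul_smul, Matrix.smul_mul, smul_add]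
    rw [smul_comm (stepSize s.V)]
    rfl
  refine ⟨⟨?_, ?_, ?_⟩, ?_⟩
  -- The two congruences cancel, so `ΔY = L(ΔX)` and the affine equation persists.
  · rw [hY', hX', map_add, map_smul, map_smul, ← hT, congruence_inv_congruence hD, hYX]
    abel
  · rw [hXm]; exact (posDef_conj hA hD).smul hs
  · rw [hYm]; exact (posDef_conj hB hD.inv).smul hs
  · have := barrier_ntV_le_mean hμ hD hA hB hXm hYm
    rw [← hμ'] at this
    exact this.trans hdec

end Inner

/-! ### Growth of the barrier under a `μ`-update. -/

/-- If `βv ≤ 1`, moving towards the minimum only lowers `ψ`; otherwise `ψ(t) ≤ 4(t - 1)²` and `v ≤ 1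
+ √ψ(v)`. Vanishing at `β = 1`, `v = 1`, it suits small `θ`. -/
lemma sqrt_psi_mul_le {v β : ℝ} (hv : 0 < v) (hβ : 1 ≤ β) :
    psi (β * v) ≤ (2 * (β - 1) + 2 * β * Real.sqrt (psi v)) ^ 2 := by
  have hβv : 0 < β * v := by positivity
  have hw := Real.sqrt_nonneg (psi v)
  have hw2 := Real.sq_sqrt (psi_nonneg hv)
  have hvw : v - 1 ≤ Real.sqrt (psi v) := Real.le_sqrt_of_sq_le (sq_sub_one_le_psi hv)
  rcases le_total (β * v) 1 with h | h
  · have h1 : psi (β * v) ≤ psi v := psi_anti hv (by nlinarith) h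
    rw [← hw2] at h1
    refine h1.trans (pow_le_pow_left₀ hw ?_ 2)
    nlinarith
  · have h1 := psi_le_four_mul h
    have h2 : β * v - 1 ≤ (β - 1) + β * Real.sqrt (psi v) := by nlinarith
    calc psi (β * v) ≤ 4 * (β * v - 1) ^ 2 := h1
      _ ≤ 4 * ((β - 1) + β * Real.sqrt (psi v)) ^ 2 := by
        gcongr
      _ = _ := by ring

/-- Same case split with `ψ(t) ≤ t² - 1`, whose leading coefficient is smaller; this suits large
`θ`. -/
lemma psi_mul_le {v β : ℝ} (hv : 0 < v) (hβ : 1 ≤ β) :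
    psi (β * v) ≤ β ^ 2 * (1 + Real.sqrt (psi v)) ^ 2 - 1 := by
  have hw := Real.sqrt_nonneg (psi v)
  have hw2 := Real.sq_sqrt (psi_nonneg hv)
  have hvw : v - 1 ≤ Real.sqrt (psi v) := Real.le_sqrt_of_sq_le (sq_sub_one_le_psi hv)
  rcases le_total (β * v) 1 with h | h
  · have h1 : psi (β * v) ≤ psi v := psi_anti hv (by nlinarith) h
    rw [← hw2] at h1
    have h2 : (1 + Real.sqrt (psi v)) ^ 2 ≤ β ^ 2 * (1 + Real.sqrt (psi v)) ^ 2 :=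
      le_mul_of_one_le_left (sq_nonneg _) (one_le_pow₀ hβ)
    nlinarith
  · have h1 := psi_le_sq_sub_one h
    have h2 : (β * v) ^ 2 ≤ (β * (1 + Real.sqrt (psi v))) ^ 2 :=
      pow_le_pow_left₀ (by positivity) (by gcongr; linarith) 2
    rw [mul_pow β (1 + _)] at h2
    linarith

lemma one_le_inv_sqrt {θ : ℝ} (h0 : 0 < θ) (h1 : θ < 1) : 1 ≤ 1 / Real.sqrt (1 - θ) := by
  rw [le_div_iff₀ (Real.sqrt_pos.2 (by linarith)), one_mul]
  exact Real.sqrt_le_one.2 (by linarith)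

/-- The growth of the barrier under an update of the barrier parameter. -/
lemma sum_psi_mul_le {n : ℕ} {v : Fin n → ℝ} (hv : ∀ i, 0 < v i) {τ θ : ℝ} (h0 : 0 < θ)
    (h1 : θ < 1) (hτ : ∑ i, psi (v i) ≤ τ) :
    ∑ i, psi (1 / Real.sqrt (1 - θ) * v i) ≤ Psi0 n τ θ := by
  have hβ := one_le_inv_sqrt h0 h1
  set w : Fin n → ℝ := fun i => Real.sqrt (psi (v i)) with hw
  have hw2 : ∑ i, w i ^ 2 ≤ τ := by
    refine le_trans (le_of_eq (Finset.sum_congr rfl fun i _ => ?_)) hτ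
    exact Real.sq_sqrt (psi_nonneg (hv i))
  have hτ0 : 0 ≤ τ := (Finset.sum_nonneg fun i _ => sq_nonneg (w i)).trans hw2
  set m := Real.sqrt n with hm
  set t := Real.sqrt τ with ht
  have hm0 : 0 ≤ m := Real.sqrt_nonneg _
  have ht0 : 0 ≤ t := Real.sqrt_nonneg _
  have hmm : m ^ 2 = n := Real.sq_sqrt (Nat.cast_nonneg n)
  have htt : t ^ 2 = τ := Real.sq_sqrt hτ0
  have hw1 : ∑ i, w i ≤ m * t := by
    have hc := sq_sum_le_card_mul_sum_sq (s := Finset.univ) (f := w)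
    rw [Finset.card_univ, Fintype.card_fin] at hc
    refine le_of_sq_le_sq (hc.trans ?_) (by positivity)
    rw [mul_pow, hmm, htt]
    gcongr
  have ha2 : Real.sqrt (1 - θ) ^ 2 = 1 - θ := Real.sq_sqrt (by linarith)
  have ha0 : 0 < Real.sqrt (1 - θ) := Real.sqrt_pos.2 (by linarith)
  set a := Real.sqrt (1 - θ)
  set β := 1 / a with hβdef
  have hs2 : Real.sqrt 2 ^ 2 = 2 := Real.sq_sqrt (by norm_num)
  have hs0 : 0 ≤ Real.sqrt 2 := Real.sqrt_nonneg 2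
  have hP : Psi0 n τ θ = β ^ 2 * (2 * (Real.sqrt 2 * t + m * θ) ^ 2) := by
    rw [Psi0, Real.sqrt_mul (by norm_num), ← ha2, ← hm, ← ht, hβdef]
    field_simp
  have hβa : β ^ 2 * (1 - θ) = 1 := by
    rw [← ha2, hβdef]; field_simp
  rw [hP]
  -- With `a = √(1 - θ)`, the first estimate needs `√2 (1 - a) ≤ θ = (1 - a)(1 + a)`, which fails
  -- for `θ` near 1. The second needs `θ ≤ 2θ²`, that is `θ ≥ 1/2`.
  rcases le_total θ (1 / 2) with h | h
  · calc ∑ i, psi (β * v i) ≤ ∑ i, (2 * (β - 1) + 2 * β * w i) ^ 2 :=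
          Finset.sum_le_sum fun i _ => sqrt_psi_mul_le (hv i) hβ
      _ = 4 * (β - 1) ^ 2 * n + 8 * (β - 1) * β * ∑ i, w i + 4 * β ^ 2 * ∑ i, w i ^ 2 := by
        have hn : 4 * (β - 1) ^ 2 * (n : ℝ) = ∑ _i : Fin n, 4 * (β - 1) ^ 2 := by
          simp [mul_comm]
        rw [hn, Finset.mul_sum, Finset.mul_sum, ← Finset.sum_add_distrib,
          ← Finset.sum_add_distrib]
        exact Finset.sum_congr rfl fun i _ => by ring
      _ ≤ 4 * (β - 1) ^ 2 * m ^ 2 + 8 * (β - 1) * β * (m * t) + 4 * β ^ 2 * t ^ 2 := by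
        rw [hmm, htt]
        have : 0 ≤ 8 * (β - 1) * β := mul_nonneg (by linarith) (by linarith)
        gcongr
      _ = β ^ 2 * (2 * (Real.sqrt 2 * (m * (1 - a) + t)) ^ 2) := by
        rw [mul_pow (Real.sqrt 2), hs2, hβdef]
        field_simp
        ring
      _ ≤ β ^ 2 * (2 * (Real.sqrt 2 * t + m * θ) ^ 2) := by
        have ha1 : a ≤ 1 := by nlinarith
        have h2 : Real.sqrt 2 ≤ 1 + a := by
          have e1 : Real.sqrt 2 ≤ 1.42 := by
            rw [Real.sqrt_le_iff]; norm_num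
          nlinarith
        have h3 : Real.sqrt 2 * (1 - a) ≤ θ := by nlinarith
        have h4 : Real.sqrt 2 * (m * (1 - a) + t) ≤ Real.sqrt 2 * t + m * θ := by nlinarith
        have h5 : 0 ≤ Real.sqrt 2 * (m * (1 - a) + t) :=
          mul_nonneg hs0 (add_nonneg (mul_nonneg hm0 (by linarith)) ht0)
        gcongr
  · calc ∑ i, psi (β * v i) ≤ ∑ i, (β ^ 2 * (1 + w i) ^ 2 - 1) :=
          Finset.sum_le_sum fun i _ => psi_mul_le (hv i) hβ
      _ = (β ^ 2 - 1) * n + 2 * β ^ 2 * ∑ i, w i + β ^ 2 * ∑ i, w i ^ 2 := by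
        have hn : (β ^ 2 - 1) * (n : ℝ) = ∑ _i : Fin n, (β ^ 2 - 1) := by
          rw [Finset.sum_const, Finset.card_univ, Fintype.card_fin, nsmul_eq_mul, mul_comm]
        rw [hn, Finset.mul_sum, Finset.mul_sum, ← Finset.sum_add_distrib,
          ← Finset.sum_add_distrib]
        exact Finset.sum_congr rfl fun i _ => by ring
      _ ≤ (β ^ 2 - 1) * m ^ 2 + 2 * β ^ 2 * (m * t) + β ^ 2 * t ^ 2 := by
        rw [hmm, htt]
        gcongr
      _ = β ^ 2 * (m ^ 2 * θ + 2 * (m * t) + t ^ 2) := by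
        linear_combination m ^ 2 * hβa
      _ ≤ β ^ 2 * (2 * (Real.sqrt 2 * t + m * θ) ^ 2) := by
        have e1 : 1 ≤ Real.sqrt 2 := by
          rw [Real.one_le_sqrt]; norm_num
        have e2 : m ^ 2 * θ ≤ 2 * (m ^ 2 * θ ^ 2) := by nlinarith [mul_nonneg (sq_nonneg m) h0.le]
        have e3 : m * t ≤ 2 * (Real.sqrt 2 * θ) * (m * t) :=
          le_mul_of_one_le_left (by positivity) (by nlinarith)
        have e4 : (Real.sqrt 2 * t + m * θ) ^ 2 =
            2 * t ^ 2 + 2 * (Real.sqrt 2 * θ) * (m * t) + m ^ 2 * θ ^ 2 := by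
          linear_combination t ^ 2 * hs2
        rw [e4]
        gcongr
        nlinarith [sq_nonneg t]

section Outer

variable {n : ℕ}

lemma barrier_smul {V : SymMat n} (hV : (V : Matrix (Fin n) (Fin n) ℝ).PosDef) (β : ℝ) :
    barrier (β • V) = ∑ i, psi (β * hV.isHermitian.eigenvalues i) := by
  have h1 : cfc (fun x : ℝ => β * x) (V : Matrix (Fin n) (Fin n) ℝ) =
      β • (V : Matrix (Fin n) (Fin n) ℝ) := by
    rw [cfc_const_mul β (fun x : ℝ => x) _ (continuousOn_spectrum _ _), cfc_fun_id hV.isHermitian]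
  have h2 : cfc psi (β • (V : Matrix (Fin n) (Fin n) ℝ)) =
      cfc (fun x => psi (β * x)) (V : Matrix (Fin n) (Fin n) ℝ) := by
    rw [← h1]
    exact (cfc_comp' psi (fun x : ℝ => β * x) _
      (((V : Matrix (Fin n) (Fin n) ℝ).finite_real_spectrum.image _).continuousOn _)
      (continuousOn_spectrum _ _) hV.isHermitian.isSelfAdjoint).symm
  rw [barrier, coe_matFun, Submodule.coe_smul, h2, trace_cfc hV.isHermitian]

lemma outer_step {τ ε θ : ℝ} (h0 : 0 < θ) (h1 : θ < 1) {s s' : State n}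
    (hX : (s.X : Matrix (Fin n) (Fin n) ℝ).PosDef) (hY : (s.Y : Matrix (Fin n) (Fin n) ℝ).PosDef)
    (hμ : 0 < s.μ) (h : OuterStep τ ε θ s s') : s'.Psi ≤ Psi0 n τ θ := by
  obtain ⟨hτ, -, hX', hY', hμ'⟩ := h
  obtain ⟨hV, -, -⟩ := nt_spec hX hY hμ
  change (s.V : Matrix (Fin n) (Fin n) ℝ).PosDef at hV
  -- The scaling matrix does not involve `μ`, so an update only multiplies `V` by a scalar.
  have hV' : s'.V = (1 / Real.sqrt (1 - θ)) • s.V := by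
    simp only [State.V, ntV, hX', hY', hμ', smul_smul]
    rw [Real.sqrt_mul (by linarith), one_div_mul_one_div]
  rw [State.Psi, hV', barrier_smul hV]
  refine sum_psi_mul_le (fun i => hV.eigenvalues_pos i) h0 h1 ?_
  rw [← barrier_eq_sum hV]
  exact hτ

/-- Covers the initial state, where no update has yet taken place. -/
lemma le_Psi0 {τ θ : ℝ} (hτ : 0 ≤ τ) (h0 : 0 < θ) (h1 : θ < 1) : τ ≤ Psi0 n τ θ := by
  have h2 : 2 ≤ 2 / (1 - θ) := by
    rw [le_div_iff₀ (by linarith)]; linarith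
  have h3 : 2 * τ ≤ (Real.sqrt (2 * τ) + Real.sqrt n * θ) ^ 2 := by
    have e := Real.sq_sqrt (show 0 ≤ 2 * τ by linarith)
    have : 0 ≤ Real.sqrt n * θ := mul_nonneg (Real.sqrt_nonneg _) h0.le
    nlinarith [Real.sqrt_nonneg (2 * τ)]
  calc τ ≤ 2 * (2 * τ) := by linarith
    _ ≤ 2 / (1 - θ) * (Real.sqrt (2 * τ) + Real.sqrt n * θ) ^ 2 := by gcongr

lemma mu0_pos {X Y : SymMat n} (hn : 0 < n) (hX : (X : Matrix (Fin n) (Fin n) ℝ).PosDef)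
    (hY : (Y : Matrix (Fin n) (Fin n) ℝ).PosDef) : 0 < mu0 X Y := by
  have : Nonempty (Fin n) := ⟨⟨0, hn⟩⟩
  refine div_pos ?_ (Nat.cast_pos.2 hn)
  have h := (posDef_conj hY (posDef_sqrt hX)).trace_pos
  rwa [Matrix.mul_assoc, trace_mul_comm, Matrix.mul_assoc, sqrt_mul_sqrt hX,
    trace_mul_comm] at h

end Outer

/-! ### Counting the iterations of an execution. -/

section Run

variable {n : ℕ} {L : SymMat n →ₗ[ℝ] SymMat n} {Q X₀ Y₀ : SymMat n} {τ ε θ : ℝ}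

lemma run_feasible (hin : IsInput L Q X₀ Y₀ τ ε θ) {N : ℕ} {s : ℕ → State n}
    (hrun : IsRun L X₀ Y₀ τ ε θ N s) :
    ∀ i ≤ N, StrictlyFeasible L Q (s i).X (s i).Y ∧ 0 < (s i).μ := by
  intro i
  induction i with
  | zero =>
    intro _
    rw [hrun.init]
    exact ⟨hin.feasible, mu0_pos hin.n_pos hin.feasible.2.1 hin.feasible.2.2⟩
  | succ i ih =>
    intro hi
    obtain ⟨hf, hμ⟩ := ih (by omega)
    rcases hrun.step i (by omega) with h | h
    · refine ⟨(inner_step hin.monotone hin.one_le_tau hf hμ h).1, ?_⟩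
      obtain ⟨-, _, _, -, -, -, hμ'⟩ := h
      rwa [hμ']
    · obtain ⟨-, -, hX, hY, hμ'⟩ := h
      rw [hX, hY, hμ']
      exact ⟨hf, mul_pos (by linarith [hin.theta_lt_one]) hμ⟩

/-- If the loops have not both stopped, the next iterate exists and is unique. -/
lemma existsUnique_step (hL : IsMonotone L) {s : State n} (hf : StrictlyFeasible L Q s.X s.Y)
    (h : ¬ Halted τ ε s) : ∃! s', Step L τ ε θ s s' := by
  rcases lt_or_ge τ s.Psi with hτ | hτ
  · obtain ⟨S, T, hST, huniq⟩ := existsUnique_scaledDirection hL hf.2.1 hf.2.2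
    refine ⟨⟨s.X + stepSize s.V • (Real.sqrt s.μ • congruence (ntD s.X s.Y) S),
      s.Y + stepSize s.V • (Real.sqrt s.μ • congruence (ntD s.X s.Y)⁻¹ T), s.μ⟩,
      Or.inl ⟨hτ, S, T, hST, rfl, rfl, rfl⟩, ?_⟩
    rintro ⟨X', Y', μ'⟩ (⟨-, S', T', hST', hX, hY, hμ⟩ | ⟨hle, -⟩)
    · obtain ⟨rfl, rfl⟩ := huniq S' T' hST'
      simp only at hX hY hμ
      rw [hX, hY, hμ]
    · exact absurd hle (not_le.2 hτ)
  · have hε : ε ≤ n * s.μ := by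
      by_contra hc
      exact h ⟨hτ, not_le.1 hc⟩
    refine ⟨⟨s.X, s.Y, (1 - θ) * s.μ⟩, Or.inr ⟨hτ, hε, rfl, rfl, rfl⟩, ?_⟩
    rintro ⟨X', Y', μ'⟩ (⟨hlt, -⟩ | ⟨-, -, hX, hY, hμ⟩)
    · exact absurd hτ (not_le.2 hlt)
    · simp only at hX hY hμ
      rw [hX, hY, hμ]

/-- The iteration count after `k` outer iterations. -/
lemma run_count (hin : IsInput L Q X₀ Y₀ τ ε θ) {N : ℕ} {s : ℕ → State n}
    (hrun : IsRun L X₀ Y₀ τ ε θ N s) {B : ℝ}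
    (hout : ∀ i < N, OuterStep τ ε θ (s i) (s (i + 1)) → (s (i + 1)).Psi ≤ B) :
    ∀ i ≤ N, ∃ k : ℕ, (s i).μ = (1 - θ) ^ k * mu0 X₀ Y₀ ∧
      ((k = 0 ∧ i = 0) ∨ (∃ m, k = m + 1 ∧ ε ≤ n * ((1 - θ) ^ m * mu0 X₀ Y₀)) ∧ (s i).Psi ≤ B ∧
        i + 25 * (1 + Real.log (2 * Real.sqrt (2 * B) + 1)) ^ 2 * Real.sqrt (s i).Psi ≤
          k * (1 + 25 * (1 + Real.log (2 * Real.sqrt (2 * B) + 1)) ^ 2 * Real.sqrt B)) := by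
  set ℓ := 1 + Real.log (2 * Real.sqrt (2 * B) + 1) with hℓ
  have hℓ1 : 1 ≤ ℓ := by
    have : 0 ≤ Real.log (2 * Real.sqrt (2 * B) + 1) :=
      Real.log_nonneg (by linarith [Real.sqrt_nonneg (2 * B)])
    linarith
  have hc1 : 1 ≤ 25 * ℓ ^ 2 := by nlinarith
  set c := 25 * ℓ ^ 2 with hc
  intro i
  induction i with
  | zero =>
    intro _
    exact ⟨0, by rw [hrun.init, pow_zero, one_mul]; rfl, Or.inl ⟨rfl, rfl⟩⟩
  | succ i ih =>
    intro hi
    obtain ⟨k, hk, hcase⟩ := ih (by omega)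
    obtain ⟨hf, hμ⟩ := run_feasible hin hrun i (by omega)
    rcases hrun.step i (by omega) with h | h
    · have hμ' : (s (i + 1)).μ = (s i).μ := by
        obtain ⟨-, _, _, -, -, -, hμ'⟩ := h
        exact hμ'
      have hgt : τ < (s i).Psi := h.1
      refine ⟨k, hμ'.trans hk, ?_⟩
      -- No inner step can come first, since initially `Ψ ≤ τ`; hence the count carries the factor
      -- `k`, not `k + 1`.
      rcases hcase with ⟨-, rfl⟩ | ⟨hε, hB, hcount⟩
      · have := hin.init_le
        rw [← hrun.init] at this
        linarith
      · have hdec := (inner_step hin.monotone hin.one_le_tau hf hμ h).2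
        have hb : 1 ≤ (s i).Psi := hin.one_le_tau.trans hgt.le
        have hge := decrease_ge hb hB (sqrt_barrier_le_delta (nt_spec hf.2.1 hf.2.2 hμ).1)
        rw [← hℓ, ← hc] at hge
        have hlt : (s (i + 1)).Psi ≤ (s i).Psi - 2 * Real.sqrt (s i).Psi / c :=
          hdec.trans (sub_le_sub_left hge _)
        have hs1 : 1 ≤ Real.sqrt (s i).Psi := Real.one_le_sqrt.2 hb
        have hs2 := Real.sq_sqrt (zero_le_one.trans hb)
        have hc0 : 0 < c := by linarith
        -- `(√Ψ - 1/c)²` exceeds `Ψ - 2√Ψ/c` by `1/c²`, and `√Ψ ≥ 1 ≥ 1/c` makes its root `√Ψ -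
        -- 1/c`.
        have hsq : Real.sqrt (s (i + 1)).Psi ≤ Real.sqrt (s i).Psi - 1 / c := by
          have : 1 / c ≤ 1 := by rw [div_le_one hc0]; exact hc1
          refine Real.sqrt_le_iff.2 ⟨by linarith, hlt.trans ?_⟩
          have e : (Real.sqrt (s i).Psi - 1 / c) ^ 2 =
              (s i).Psi - 2 * Real.sqrt (s i).Psi / c + (1 / c) ^ 2 := by
            rw [← hs2]
            simp only [Real.sqrt_sq (Real.sqrt_nonneg _)]
            ring
          rw [e]
          linarith [sq_nonneg (1 / c)]
        have h0 : 0 ≤ 2 * Real.sqrt (s i).Psi / c := by positivity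
        refine Or.inr ⟨hε, by linarith, ?_⟩
        have hmul : c * Real.sqrt (s (i + 1)).Psi ≤ c * Real.sqrt (s i).Psi - 1 := by
          calc c * Real.sqrt (s (i + 1)).Psi ≤ c * (Real.sqrt (s i).Psi - 1 / c) := by gcongr
            _ = c * Real.sqrt (s i).Psi - 1 := by field_simp
        push_cast
        linarith
    · have hB := hout i (by omega) h
      obtain ⟨-, hε, -, -, hμ'⟩ := h
      refine ⟨k + 1, by rw [hμ', hk, pow_succ]; ring, Or.inr ⟨⟨k, rfl, hk ▸ hε⟩, hB, ?_⟩⟩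
      have hsB := mul_le_mul_of_nonneg_left (Real.sqrt_le_sqrt hB) (zero_le_one.trans hc1)
      push_cast
      rcases hcase with ⟨rfl, rfl⟩ | ⟨-, -, hcount⟩
      · push_cast; linarith
      · have : 0 ≤ c * Real.sqrt (s i).Psi := by positivity
        linarith

/-- Take logarithms and use `log(1 - θ) ≤ -θ`. Here `m` counts the updates before the last one,
since the loop test reads `μ` before it is reduced. -/
lemma outer_count_le (hθ : 0 < θ) (hθ1 : θ < 1) (hε : 0 < ε) {m : ℕ} {a : ℝ} (ha : 0 < a)
    (h : ε ≤ (1 - θ) ^ m * a) : (m : ℝ) ≤ 1 / θ * Real.log (a / ε) := by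
  have h1 : 0 < 1 - θ := by linarith
  have h2 := Real.log_le_log hε h
  rw [Real.log_mul (by positivity) ha.ne', Real.log_pow] at h2
  have h3 := Real.log_le_sub_one_of_pos h1
  rw [Real.log_div ha.ne' hε.ne', div_mul_eq_mul_div, one_mul, le_div_iff₀ hθ]
  have h4 : (m : ℝ) * Real.log (1 - θ) ≤ m * (1 - θ - 1) := by gcongr
  linarith

lemma run_length_le (hin : IsInput L Q X₀ Y₀ τ ε θ) {N : ℕ} {s : ℕ → State n}
    (hrun : IsRun L X₀ Y₀ τ ε θ N s) {B : ℝ} (hB : 1 ≤ B)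
    (hout : ∀ i < N, OuterStep τ ε θ (s i) (s (i + 1)) → (s (i + 1)).Psi ≤ B) :
    (N : ℝ) ≤ 66 * (1 + Real.log (2 * Real.sqrt (2 * B) + 1)) ^ 2 * Real.sqrt B *
      max 1 (1 / θ * Real.log (n * mu0 X₀ Y₀ / ε)) := by
  obtain ⟨k, -, hcase⟩ := run_count hin hrun hout N le_rfl
  have hℓ1 : 1 ≤ 1 + Real.log (2 * Real.sqrt (2 * B) + 1) := by
    have : 0 ≤ Real.log (2 * Real.sqrt (2 * B) + 1) :=
      Real.log_nonneg (by linarith [Real.sqrt_nonneg (2 * B)])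
    linarith
  set ℓ := 1 + Real.log (2 * Real.sqrt (2 * B) + 1)
  set x := 1 / θ * Real.log (n * mu0 X₀ Y₀ / ε)
  have hsB : 1 ≤ Real.sqrt B := Real.one_le_sqrt.2 hB
  have hm0 : 1 ≤ max 1 x := le_max_left _ _
  rcases hcase with ⟨-, rfl⟩ | ⟨⟨m, rfl, hm⟩, -, hcount⟩
  · push_cast; positivity
  · have hmu := mu0_pos hin.n_pos hin.feasible.2.1 hin.feasible.2.2
    have hn : (0 : ℝ) < n := Nat.cast_pos.2 hin.n_pos
    have hmx : (m : ℝ) ≤ x :=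
      outer_count_le hin.theta_pos hin.theta_lt_one hin.eps_pos (mul_pos hn hmu)
        (hm.trans (le_of_eq (by ring)))
    have hk : ((m + 1 : ℕ) : ℝ) ≤ 2 * max 1 x := by
      push_cast; linarith [le_max_right 1 x]
    have h1 : 1 ≤ ℓ ^ 2 * Real.sqrt B := one_le_mul_of_one_le_of_one_le (one_le_pow₀ hℓ1) hsB
    have h0 : 0 ≤ 25 * ℓ ^ 2 * Real.sqrt (s N).Psi := by positivity
    calc (N : ℝ) ≤ ((m + 1 : ℕ) : ℝ) * (1 + 25 * ℓ ^ 2 * Real.sqrt B) := by linarith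
      -- The two factors account for `66 = 2 · 33`: `m + 1 ≤ 2 max{1, x}`, and `1 + 25y ≤ 33y` for
      -- `y = ℓ²√B ≥ 1`.
      _ ≤ (2 * max 1 x) * (33 * (ℓ ^ 2 * Real.sqrt B)) := by
        gcongr
        linarith
      _ = 66 * ℓ ^ 2 * Real.sqrt B * max 1 x := by ring

lemma run_outer_le (hin : IsInput L Q X₀ Y₀ τ ε θ) {N : ℕ} {s : ℕ → State n}
    (hrun : IsRun L X₀ Y₀ τ ε θ N s) :
    ∀ i < N, OuterStep τ ε θ (s i) (s (i + 1)) → (s (i + 1)).Psi ≤ Psi0 n τ θ := fun i hi h => by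
  obtain ⟨hf, hμ⟩ := run_feasible hin hrun i hi.le
  exact outer_step hin.theta_pos hin.theta_lt_one hf.2.1 hf.2.2 hμ h

lemma run_psi_le (hin : IsInput L Q X₀ Y₀ τ ε θ) {N : ℕ} {s : ℕ → State n}
    (hrun : IsRun L X₀ Y₀ τ ε θ N s) {i : ℕ} (hi : i ≤ N) : (s i).Psi ≤ Psi0 n τ θ := by
  obtain ⟨k, -, ⟨-, rfl⟩ | ⟨-, h, -⟩⟩ := run_count hin hrun (run_outer_le hin hrun) i hi
  · rw [hrun.init]
    exact hin.init_le.trans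
      (le_Psi0 (zero_le_one.trans hin.one_le_tau) hin.theta_pos hin.theta_lt_one)
  · exact h

lemma one_le_Psi0 (hin : IsInput L Q X₀ Y₀ τ ε θ) : 1 ≤ Psi0 n τ θ :=
  hin.one_le_tau.trans
    (le_Psi0 (zero_le_one.trans hin.one_le_tau) hin.theta_pos hin.theta_lt_one)

end Run

/-! ### The asymptotic bound for large updates. -/

lemma Psi0_le {n : ℕ} {c τ θ θ₂ : ℝ} (hc : 0 ≤ c) (hθ : 0 < θ) (hθ₂ : θ ≤ θ₂) (h1 : θ₂ < 1)
    (hτ : τ ≤ c * n) : Psi0 n τ θ ≤ 2 / (1 - θ₂) * (Real.sqrt (2 * c) + 1) ^ 2 * n := by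
  have h2 : Real.sqrt (2 * τ) ≤ Real.sqrt (2 * c) * Real.sqrt n := by
    rw [← Real.sqrt_mul (by linarith)]
    exact Real.sqrt_le_sqrt (by linarith)
  have h3 : Real.sqrt n * θ ≤ Real.sqrt n := mul_le_of_le_one_right (Real.sqrt_nonneg _)
    (by linarith)
  have h4 : 0 < 1 - θ₂ := by linarith
  calc Psi0 n τ θ ≤ 2 / (1 - θ₂) * (Real.sqrt (2 * c) * Real.sqrt n + Real.sqrt n) ^ 2 := by
        unfold Psi0
        gcongr
    _ = 2 / (1 - θ₂) * (Real.sqrt (2 * c) + 1) ^ 2 * Real.sqrt n ^ 2 := by ring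
    _ = _ := by rw [Real.sq_sqrt (Nat.cast_nonneg n)]

/-- Additive constants are absorbed through `log n ≥ log 2`. -/
lemma log_factor_le {n : ℕ} (hn : 2 ≤ n) {a B : ℝ} (ha : 0 ≤ a) (hB : B ≤ a * n) :
    1 + Real.log (2 * Real.sqrt (2 * B) + 1) ≤
      ((1 + Real.log (2 * Real.sqrt (2 * a) + 1)) / Real.log 2 + 1) * Real.log n := by
  have hn' : (2 : ℝ) ≤ n := by exact_mod_cast hn
  have hl2 : 0 < Real.log 2 := Real.log_pos (by norm_num)
  have hln : Real.log 2 ≤ Real.log n := Real.log_le_log (by norm_num) hn'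
  have hb : 0 ≤ Real.log (2 * Real.sqrt (2 * a) + 1) :=
    Real.log_nonneg (by linarith [Real.sqrt_nonneg (2 * a)])
  have hsn : Real.sqrt n ≤ n := by
    rw [Real.sqrt_le_iff]; constructor <;> nlinarith
  have h1 : Real.sqrt (2 * B) ≤ Real.sqrt (2 * a) * n := by
    calc Real.sqrt (2 * B) ≤ Real.sqrt (2 * a * n) := Real.sqrt_le_sqrt (by linarith)
      _ = Real.sqrt (2 * a) * Real.sqrt n := Real.sqrt_mul (by linarith) _
      _ ≤ _ := by gcongr
  have h2 : Real.log (2 * Real.sqrt (2 * B) + 1) ≤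
      Real.log (2 * Real.sqrt (2 * a) + 1) + Real.log n := by
    rw [← Real.log_mul (by positivity) (by linarith)]
    exact Real.log_le_log (by positivity) (by nlinarith)
  have h3 : 1 + Real.log (2 * Real.sqrt (2 * a) + 1) ≤
      (1 + Real.log (2 * Real.sqrt (2 * a) + 1)) / Real.log 2 * Real.log n := by
    rw [div_mul_eq_mul_div, le_div_iff₀ hl2]
    gcongr
  linarith

/-- The hypothesis `2ε ≤ n` gives `log(n/ε) ≥ log 2`, which absorbs constants; `max 1 M` keeps the
logarithm nonnegative for every `M`. -/
lemma outer_factor_le {n : ℕ} {ε θ θ₁ μ M : ℝ} (hε : 0 < ε) (hn : 2 * ε ≤ n) (hθ₁ : 0 < θ₁)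
    (hθ : θ₁ ≤ θ) (hμ : 0 < μ) (hM : μ ≤ M) :
    max 1 (1 / θ * Real.log (n * μ / ε)) ≤
      (1 / Real.log 2 + 1 / θ₁ * (1 + Real.log (max 1 M) / Real.log 2)) * Real.log (n / ε) := by
  have hl2 : 0 < Real.log 2 := Real.log_pos (by norm_num)
  have hnε : 2 ≤ n / ε := by rwa [le_div_iff₀ hε]
  have hl : Real.log 2 ≤ Real.log (n / ε) := Real.log_le_log (by norm_num) hnε
  have hM0 : 0 ≤ Real.log (max 1 M) := Real.log_nonneg (le_max_left _ _)
  set x := Real.log (n / ε)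
  have hx : 0 < x := hl2.trans_le hl
  have h1 : 1 ≤ 1 / Real.log 2 * x := by
    rw [div_mul_eq_mul_div, one_mul, one_le_div hl2]; exact hl
  have h2 : Real.log (n * μ / ε) ≤ (1 + Real.log (max 1 M) / Real.log 2) * x := by
    have e1 : Real.log (n * μ / ε) = x + Real.log μ := by
      rw [mul_div_right_comm, Real.log_mul (by linarith) hμ.ne']
    have e2 : Real.log μ ≤ Real.log (max 1 M) := Real.log_le_log hμ (hM.trans (le_max_right _ _))
    have e3 : Real.log (max 1 M) ≤ Real.log (max 1 M) / Real.log 2 * x := by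
      rw [div_mul_eq_mul_div, le_div_iff₀ hl2]
      gcongr
    linarith
  have h3 : 0 ≤ (1 + Real.log (max 1 M) / Real.log 2) * x := by positivity
  have h4 : 1 / θ * Real.log (n * μ / ε) ≤
      1 / θ₁ * ((1 + Real.log (max 1 M) / Real.log 2) * x) :=
    calc 1 / θ * Real.log (n * μ / ε) ≤ 1 / θ * ((1 + Real.log (max 1 M) / Real.log 2) * x) := by
          have : 0 < θ := hθ₁.trans_le hθ
          gcongr
      _ ≤ _ := by gcongr
  have h5 : 0 ≤ 1 / θ₁ * ((1 + Real.log (max 1 M) / Real.log 2) * x) := by positivity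
  refine max_le ?_ ?_ <;> linarith

/-- The iteration bound for large updates. -/
lemma exists_large_update_bound (c θ₁ θ₂ M : ℝ) (hθ₁ : 0 < θ₁) (hθ₂ : θ₂ < 1) :
    ∃ C : ℝ, 0 < C ∧
      ∀ (n : ℕ) (L : SymMat n →ₗ[ℝ] SymMat n) (Q X₀ Y₀ : SymMat n) (τ ε θ : ℝ),
        IsInput L Q X₀ Y₀ τ ε θ → 2 ≤ n → τ ≤ c * n → θ₁ ≤ θ → θ ≤ θ₂ → mu0 X₀ Y₀ ≤ M →
        2 * ε ≤ n → ∀ (N : ℕ) (s : ℕ → State n), IsRun L X₀ Y₀ τ ε θ N s →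
          (N : ℝ) ≤ C * (Real.sqrt n * Real.log n ^ 2 * Real.log (n / ε)) := by
  have h4 : 0 < 1 - θ₂ := by linarith
  have hl2 : 0 < Real.log 2 := Real.log_pos (by norm_num)
  have ha : 0 < 2 / (1 - θ₂) * (Real.sqrt (2 * c) + 1) ^ 2 := by positivity
  set a := 2 / (1 - θ₂) * (Real.sqrt (2 * c) + 1) ^ 2
  have hb : 0 ≤ Real.log (2 * Real.sqrt (2 * a) + 1) :=
    Real.log_nonneg (by linarith [Real.sqrt_nonneg (2 * a)])
  have hM0 : 0 ≤ Real.log (max 1 M) := Real.log_nonneg (le_max_left _ _)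
  have hb' : 0 < (1 + Real.log (2 * Real.sqrt (2 * a) + 1)) / Real.log 2 + 1 := by positivity
  have hE : 0 < 1 / Real.log 2 + 1 / θ₁ * (1 + Real.log (max 1 M) / Real.log 2) := by positivity
  set b := (1 + Real.log (2 * Real.sqrt (2 * a) + 1)) / Real.log 2 + 1
  set E := 1 / Real.log 2 + 1 / θ₁ * (1 + Real.log (max 1 M) / Real.log 2)
  refine ⟨66 * b ^ 2 * Real.sqrt a * E, by positivity, ?_⟩
  intro n L Q X₀ Y₀ τ ε θ hin hn hτ hθ hθ' hμ hε N s hrun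
  have hn0 : (0 : ℝ) < n := Nat.cast_pos.2 hin.n_pos
  -- For negative `c` there are no inputs, because `τ ≥ 1`; the constant above is positive even
  -- then.
  have hc : 0 ≤ c := by
    by_contra! hc
    have := hin.one_le_tau
    nlinarith
  have h1 := run_length_le hin hrun (one_le_Psi0 hin) (run_outer_le hin hrun)
  have hP := Psi0_le hc hin.theta_pos hθ' hθ₂ hτ
  have h2 := log_factor_le hn ha.le hP
  have h3 := outer_factor_le hin.eps_pos hε hθ₁ hθ
    (mu0_pos hin.n_pos hin.feasible.2.1 hin.feasible.2.2) hμ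
  have h5 : Real.sqrt (Psi0 n τ θ) ≤ Real.sqrt a * Real.sqrt n := by
    rw [← Real.sqrt_mul ha.le]; exact Real.sqrt_le_sqrt hP
  have h6 : 0 ≤ 1 + Real.log (2 * Real.sqrt (2 * Psi0 n τ θ) + 1) := by
    have := Real.log_nonneg (show 1 ≤ 2 * Real.sqrt (2 * Psi0 n τ θ) + 1 by
      linarith [Real.sqrt_nonneg (2 * Psi0 n τ θ)])
    linarith
  calc (N : ℝ) ≤ _ := h1
    _ ≤ 66 * (b * Real.log n) ^ 2 * (Real.sqrt a * Real.sqrt n) * (E * Real.log (n / ε)) := by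
      gcongr
    _ = _ := by ring

end SDLCP

theorem mainTheorem1 :
    (∀ (n : ℕ) (L : SDLCP.SymMat n →ₗ[ℝ] SDLCP.SymMat n) (Q X₀ Y₀ : SDLCP.SymMat n)
        (τ ε θ : ℝ), SDLCP.IsInput L Q X₀ Y₀ τ ε θ →
      ∀ (N : ℕ) (s : ℕ → SDLCP.State n), SDLCP.IsRun L X₀ Y₀ τ ε θ N s →
        (∀ i ≤ N, SDLCP.StrictlyFeasible L Q (s i).X (s i).Y ∧
          (s i).Psi ≤ SDLCP.Psi0 n τ θ) ∧
        (¬ SDLCP.Halted τ ε (s N) → ∃! s' : SDLCP.State n, SDLCP.Step L τ ε θ (s N) s') ∧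
        (N : ℝ) ≤ 66 * (1 + Real.log (2 * Real.sqrt (2 * SDLCP.Psi0 n τ θ) + 1)) ^ 2 *
          Real.sqrt (SDLCP.Psi0 n τ θ) *
          max 1 (1 / θ * Real.log (n * SDLCP.mu0 X₀ Y₀ / ε)) ∧
        (∀ Ψ₀ : ℝ, 1 ≤ Ψ₀ →
          (∀ i < N, SDLCP.OuterStep τ ε θ (s i) (s (i + 1)) → (s (i + 1)).Psi ≤ Ψ₀) →
          (N : ℝ) ≤ 66 * (1 + Real.log (2 * Real.sqrt (2 * Ψ₀) + 1)) ^ 2 * Real.sqrt Ψ₀ *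
            max 1 (1 / θ * Real.log (n * SDLCP.mu0 X₀ Y₀ / ε)))) ∧
    (∀ c θ₁ θ₂ M : ℝ, 0 < θ₁ → θ₂ < 1 →
      ∃ C : ℝ, 0 < C ∧
        ∀ (n : ℕ) (L : SDLCP.SymMat n →ₗ[ℝ] SDLCP.SymMat n) (Q X₀ Y₀ : SDLCP.SymMat n)
          (τ ε θ : ℝ), SDLCP.IsInput L Q X₀ Y₀ τ ε θ →
          2 ≤ n → τ ≤ c * n → θ₁ ≤ θ → θ ≤ θ₂ → SDLCP.mu0 X₀ Y₀ ≤ M → 2 * ε ≤ n →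
          ∀ (N : ℕ) (s : ℕ → SDLCP.State n), SDLCP.IsRun L X₀ Y₀ τ ε θ N s →
            (N : ℝ) ≤ C * (Real.sqrt n * Real.log n ^ 2 * Real.log (n / ε))) := by
  refine ⟨?_, SDLCP.exists_large_update_bound⟩
  intro n L Q X₀ Y₀ τ ε θ hin N s hrun
  refine ⟨fun i hi => ⟨(SDLCP.run_feasible hin hrun i hi).1, SDLCP.run_psi_le hin hrun hi⟩,
    SDLCP.existsUnique_step hin.monotone (SDLCP.run_feasible hin hrun N le_rfl).1,
    SDLCP.run_length_le hin hrun (SDLCP.one_le_Psi0 hin) (SDLCP.run_outer_le hin hrun),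
    fun B hB hout => SDLCP.run_length_le hin hrun hB hout⟩
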